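/- Identify the unit circle $\mathbb T$ with $\mathbb R/\mathbb Z$ through $x\mapsto e^{2\pi i x}$ and let $|I|$ be the normalized length of an arc $I$, so that $|\mathbb T|=1$. For a finite positive Borel measure $\mu$ on $\mathbb T$ put \[ \omega_\mu(\delta)=\sup\{|\mu(I)-\mu(J)| : I,J \text{ adjacent arcs},\ |I|=|J|\le\delta\}, \] and, if $\mu$ is singular with respect to Lebesgue measure, let \[ S_\mu(z)=\exp\Big(-\int_{\mathbb T}\frac{\zeta+z}{\zeta-z}\,d\mu(\zeta)\Big),\qquad |z|<1, \] be the associated singular inner function, and $S_\mu^\alpha(z)=\exp\big(-\alpha\int_{\mathbb T}\frac{\zeta+z}{\zeta-z}\,d\mu(\zeta)\big)$ for $\alpha>0$. For $0<p<\infty$ let $D^p_{p-1}$ be the space of all holomorphic $f$ on the unit disc $\mathbb D$ with \[ \|f\|_{D^p_{p-1}}=|f(0)|+\Big(\int_{\mathbb D}(1-|z|)^{p-1}|f'(z)|^p\,dA(z)\Big)^{1/p}<\infty ; \] a function $f\in D^p_{p-1}$ is called cyclic in $D^p_{p-1}$ if there are polynomials $q_n$ with $\|q_nf-1\|_{D^p_{p-1}}\to0$.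 Theorem. Let $0<p<\infty$. Let $\varphi:(0,1]\to(0,\infty)$ be continuous and increasing (not necessarily strictly), and suppose that for some $0<\beta<1$ the function $t\mapsto\varphi(t)/t^\beta$ is almost decreasing, i.e. there is $c>0$ with $\varphi(x)/x^\beta\ge c\,\varphi(y)/y^\beta$ whenever $0<x<y\le1$. Let $\mu$ be a finite positive Borel measure on $\mathbb T$, singular with respect to Lebesgue measure, which is $\varphi$-smooth: there is $C>0$ with $\omega_\mu(\delta)\le C\,\delta\,\varphi(\delta)$ for all $\delta\in(0,1]$. Put $\langle\varphi\rangle(s)=\big(\int_s^1\frac{\varphi(t)^2}{t}\,dt\big)^{1/2}$ for $0<s\le 1$. If \[ \int_0^1\frac{\varphi(t)^p}{t}\,\langle\varphi\rangle(t)\,e^{\varepsilon\langle\varphi\rangle(t)^2}\,dt<\infty \] for some $\varepsilon>0$, then there exists $\alpha>0$ such that $S_\mu^\alpha$ belongs to $D^p_{p-1}$ and is cyclic in $D^p_{p-1}$. -/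

import Mathlib

open MeasureTheory Set Filter Topology
open scoped ENNReal

noncomputable section

/-- The half-open arc of the unit circle that starts at `a` and has normalized length `h`
(for `0 ≤ h ≤ 1`). The circle is `ℝ / ℤ`, identified with `{|ζ| = 1}` by `x ↦ exp (2 π i x)`, so that
the whole circle has length `1`. -/
def circleArc (a h : ℝ) : Set UnitAddCircle :=
  (fun x : ℝ => (x : UnitAddCircle)) '' Ico a (a + h)

/-- The values `|μ(I) - μ(J)|` over all pairs of adjacent arcs `I`, `J` with `|I| = |J| ≤ δ`. -/
def arcDifferences (μ : Measure UnitAddCircle) (δ : ℝ) : Set ℝ :=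
  {d | ∃ a h : ℝ, 0 < h ∧ h ≤ δ ∧ 2 * h ≤ 1 ∧
    d = |μ.real (circleArc a h) - μ.real (circleArc (a + h) h)|}

/-- For a finite measure the set of differences is bounded, so its supremum is a genuine one. -/
theorem bddAbove_arcDifferences (μ : Measure UnitAddCircle) [IsFiniteMeasure μ] (δ : ℝ) :
    BddAbove (arcDifferences μ δ) := by
  refine ⟨μ.real univ, ?_⟩
  rintro d ⟨a, h, -, -, -, rfl⟩
  have h1 : μ.real (circleArc a h) ≤ μ.real univ := measureReal_mono (subset_univ _)
  have h2 : μ.real (circleArc (a + h) h) ≤ μ.real univ := measureReal_mono (subset_univ _)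
  have h3 : 0 ≤ μ.real (circleArc a h) := measureReal_nonneg
  have h4 : 0 ≤ μ.real (circleArc (a + h) h) := measureReal_nonneg
  rw [abs_le]
  constructor <;> linarith

/-- The modulus of smoothness `ω_μ(δ)` of a finite measure on the circle. -/
def modulusOfSmoothness (μ : Measure UnitAddCircle) (δ : ℝ) : ℝ :=
  sSup (arcDifferences μ δ)

/-- `μ` is `φ`-smooth: `ω_μ(δ) ≤ C δ φ(δ)` on `(0, 1]` for some constant `C > 0`. -/
def IsSmoothMeasure (φ : ℝ → ℝ) (μ : Measure UnitAddCircle) : Prop :=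
  ∃ C : ℝ, 0 < C ∧ ∀ δ ∈ Ioc (0 : ℝ) 1, modulusOfSmoothness μ δ ≤ C * δ * φ δ

/-- `ψ` is almost decreasing on `(0, 1]`. -/
def AlmostDecreasing (ψ : ℝ → ℝ) : Prop :=
  ∃ c : ℝ, 0 < c ∧ ∀ x ∈ Ioc (0 : ℝ) 1, ∀ y ∈ Ioc (0 : ℝ) 1, x < y → c * ψ y ≤ ψ x

/-- `⟨φ⟩(s) = (∫_s^1 φ(t)² / t dt)^(1/2)`. -/
def bracket (φ : ℝ → ℝ) (s : ℝ) : ℝ :=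
  Real.sqrt (∫ t in s..1, φ t ^ 2 / t)

/-- The Herglotz integral `∫ (ζ + z) / (ζ - z) dμ(ζ)`. -/
def herglotzIntegral (μ : Measure UnitAddCircle) (z : ℂ) : ℂ :=
  ∫ x : UnitAddCircle, ((x.toCircle : ℂ) + z) / ((x.toCircle : ℂ) - z) ∂μ

/-- The singular inner function `S_μ` on the unit disc (for a finite singular measure `μ`). -/
def singularInner (μ : Measure UnitAddCircle) (z : ℂ) : ℂ :=
  Complex.exp (-herglotzIntegral μ z)

/-- The power `S_μ ^ α`: the exponential of `α` times the holomorphic logarithm `-∫ (ζ + z) / (ζ - z) dμ(ζ)`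
of `S_μ`, which is real at the origin. -/
def singularInnerPow (μ : Measure UnitAddCircle) (α : ℝ) (z : ℂ) : ℂ :=
  Complex.exp ((α : ℂ) * (-herglotzIntegral μ z))

theorem singularInnerPow_natCast (μ : Measure UnitAddCircle) (n : ℕ) (z : ℂ) :
    singularInnerPow μ n z = singularInner μ z ^ n := by
  simp only [singularInnerPow, singularInner, ← Complex.exp_nat_mul, Complex.ofReal_natCast]

theorem singularInnerPow_add (μ : Measure UnitAddCircle) (α β : ℝ) (z : ℂ) :
    singularInnerPow μ (α + β) z = singularInnerPow μ α z * singularInnerPow μ β z := by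
  simp only [singularInnerPow, ← Complex.exp_add, Complex.ofReal_add, add_mul]

/-- The norm of `D^p_{p-1}`:
`|f(0)| + (∫_𝔻 (1 - |z|)^(p-1) |f'(z)|^p dA(z))^(1/p)`, with values in `[0, ∞]`. -/
def besovNorm (p : ℝ) (f : ℂ → ℂ) : ℝ≥0∞ :=
  ‖f 0‖ₑ + (∫⁻ z in Metric.ball (0 : ℂ) 1,
    ENNReal.ofReal ((1 - ‖z‖) ^ (p - 1) * ‖deriv f z‖ ^ p)) ^ (1 / p)

/-- `f` belongs to `D^p_{p-1}`: it is holomorphic in the unit disc and its norm is finite. Values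
outside the disc play no role. -/
def MemBesov (p : ℝ) (f : ℂ → ℂ) : Prop :=
  DifferentiableOn ℂ f (Metric.ball (0 : ℂ) 1) ∧ besovNorm p f < ∞

/-- `f` is cyclic in `D^p_{p-1}`: it belongs to the space and there are polynomials `q_n` such that
`‖q_n f - 1‖ → 0`. -/
def IsCyclicBesov (p : ℝ) (f : ℂ → ℂ) : Prop :=
  MemBesov p f ∧ ∃ q : ℕ → Polynomial ℂ,
    Tendsto (fun n => besovNorm p (fun z => (q n).eval z * f z - 1)) atTop (𝓝 0)

end

/-! Let `H` be the Herglotz integral of `μ`, so `S_μ ^ α = exp (-α H)`. The argument has two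
analytic inputs.

First, smoothness of `μ` is a Bloch-type condition on `H`: `|H'(z)| ≤ C φ(1 - |z|) / (1 - |z|)`
(`norm_deriv_herglotzIntegral_le_of_isSmoothMeasure`). The angular derivative of the Poisson
integral has an odd kernel, and integration by parts leaves only differences of `μ` over adjacent
arcs of equal length. This controls `Im (z H')`; Cauchy's estimate and radial integration recover
`H'` in full.

Second, this growth forces exponential integrability: the integral of `exp (l Re H)` over the circle
of radius `r` is `O(exp ((l C)² ⟨φ⟩(1 - r)²))` (`lintegral_exp_re_herglotzIntegral_le`). Indeed `F =
exp (l H / 2)` satisfies `|F'| = (l / 2) |H'| |F|`, so Littlewood-Paley turns the bound for `H'`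
into an integral inequality for the `L²` means of `F`, which Grönwall's inequality solves.

For cyclicity, invert `S_μ ^ α` approximately by `exp (α H(r z))`, replaced by a nearby polynomial
`q`. The derivative of `q S_μ ^ α - 1` tends to zero pointwise as `r → 1` and is at most a constant
times `φ(1 - |z|) / (1 - |z|) * exp (α Re H(r z))`. Its weighted `p`-th power has circle integrals
of order `φ(t) ^ p / t * exp ((p α C)² ⟨φ⟩(t)²)`, `t = 1 - |z|`, uniformly in `r`. Choosing `(p α
C)² = ε` makes this integrable, and dominated convergence finishes the proof. -/

/-! ### The Herglotz integral: holomorphy and crude bounds. -/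

theorem UnitAddCircle.norm_toCircle (x : UnitAddCircle) : ‖(x.toCircle : ℂ)‖ = 1 :=
  Circle.norm_coe _

theorem one_sub_norm_le_norm_toCircle_sub (x : UnitAddCircle) (z : ℂ) :
    1 - ‖z‖ ≤ ‖(x.toCircle : ℂ) - z‖ := by
  have h := norm_sub_norm_le (x.toCircle : ℂ) z
  rwa [UnitAddCircle.norm_toCircle] at h

theorem toCircle_sub_ne_zero (x : UnitAddCircle) {z : ℂ} (hz : ‖z‖ < 1) :
    (x.toCircle : ℂ) - z ≠ 0 := by
  have h := one_sub_norm_le_norm_toCircle_sub x z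
  rw [← norm_pos_iff]; linarith

theorem continuous_toCircle_coe : Continuous fun x : UnitAddCircle => (x.toCircle : ℂ) :=
  continuous_subtype_val.comp AddCircle.continuous_toCircle

theorem continuous_herglotzKernel {z : ℂ} (hz : ‖z‖ < 1) :
    Continuous fun x : UnitAddCircle => ((x.toCircle : ℂ) + z) / ((x.toCircle : ℂ) - z) :=
  (continuous_toCircle_coe.add continuous_const).div
    (continuous_toCircle_coe.sub continuous_const) fun x => toCircle_sub_ne_zero x hz

theorem continuous_herglotzKernelDeriv {z : ℂ} (hz : ‖z‖ < 1) :
    Continuous fun x : UnitAddCircle => 2 * (x.toCircle : ℂ) / ((x.toCircle : ℂ) - z) ^ 2 :=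
  (continuous_const.mul continuous_toCircle_coe).div
    ((continuous_toCircle_coe.sub continuous_const).pow 2)
    fun x => pow_ne_zero 2 (toCircle_sub_ne_zero x hz)

theorem norm_herglotzKernel_le (x : UnitAddCircle) {z : ℂ} (hz : ‖z‖ < 1) :
    ‖((x.toCircle : ℂ) + z) / ((x.toCircle : ℂ) - z)‖ ≤ 2 / (1 - ‖z‖) := by
  rw [norm_div]
  have h := norm_add_le (x.toCircle : ℂ) z
  rw [UnitAddCircle.norm_toCircle] at h
  exact div_le_div₀ (by norm_num) (by linarith) (by linarith)
    (one_sub_norm_le_norm_toCircle_sub x z)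

theorem norm_herglotzKernelDeriv_le (x : UnitAddCircle) {z : ℂ} {d : ℝ} (hd : 0 < d)
    (hz : ‖z‖ ≤ 1 - d) :
    ‖2 * (x.toCircle : ℂ) / ((x.toCircle : ℂ) - z) ^ 2‖ ≤ 2 / d ^ 2 := by
  rw [norm_div, norm_mul, UnitAddCircle.norm_toCircle, norm_pow]
  have h := one_sub_norm_le_norm_toCircle_sub x z
  simp only [Complex.norm_ofNat, mul_one]
  gcongr
  linarith

section Herglotz

variable (μ : Measure UnitAddCircle) [IsFiniteMeasure μ]

theorem hasDerivAt_herglotzIntegral {z : ℂ} (hz : ‖z‖ < 1) :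
    HasDerivAt (herglotzIntegral μ)
      (∫ x : UnitAddCircle, 2 * (x.toCircle : ℂ) / ((x.toCircle : ℂ) - z) ^ 2 ∂μ) z := by
  have hr : 0 < (1 - ‖z‖) / 2 := by linarith
  have hball : ∀ w ∈ Metric.ball z ((1 - ‖z‖) / 2), ‖w‖ ≤ 1 - (1 - ‖z‖) / 2 := by
    intro w hw
    rw [mem_ball_iff_norm] at hw
    have := norm_le_norm_add_norm_sub' w z
    linarith
  refine (hasDerivAt_integral_of_dominated_loc_of_deriv_le
    (F := fun w (x : UnitAddCircle) => ((x.toCircle : ℂ) + w) / ((x.toCircle : ℂ) - w))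
    (F' := fun w (x : UnitAddCircle) => 2 * (x.toCircle : ℂ) / ((x.toCircle : ℂ) - w) ^ 2)
    (bound := fun _ => 2 / ((1 - ‖z‖) / 2) ^ 2) (Metric.ball_mem_nhds z hr) ?_ ?_ ?_ ?_ ?_ ?_).2
  · filter_upwards [Metric.ball_mem_nhds z hr] with w hw
    exact (continuous_herglotzKernel (by have := hball w hw; linarith)).aestronglyMeasurable
  · refine Integrable.of_bound (continuous_herglotzKernel hz).aestronglyMeasurable
      (2 / (1 - ‖z‖)) (ae_of_all _ fun x => norm_herglotzKernel_le x hz)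
  · exact (continuous_herglotzKernelDeriv hz).aestronglyMeasurable
  · exact ae_of_all _ fun x w hw => norm_herglotzKernelDeriv_le x hr (hball w hw)
  · exact integrable_const _
  · refine ae_of_all _ fun x w hw => ?_
    have hne : (x.toCircle : ℂ) - w ≠ 0 :=
      toCircle_sub_ne_zero x (by have := hball w hw; linarith)
    have h := ((hasDerivAt_id w).const_add (x.toCircle : ℂ)).div
      ((hasDerivAt_id w).const_sub (x.toCircle : ℂ)) hne
    refine h.congr_deriv ?_
    simp only [id]
    congr 1
    ring

theorem differentiableOn_herglotzIntegral :
    DifferentiableOn ℂ (herglotzIntegral μ) (Metric.ball 0 1) := fun z hz =>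
  (hasDerivAt_herglotzIntegral μ (by simpa using hz)).differentiableAt.differentiableWithinAt

theorem norm_herglotzIntegral_le {z : ℂ} (hz : ‖z‖ < 1) :
    ‖herglotzIntegral μ z‖ ≤ 2 / (1 - ‖z‖) * μ.real univ :=
  norm_integral_le_of_norm_le_const (ae_of_all _ fun x => norm_herglotzKernel_le x hz)

theorem norm_deriv_herglotzIntegral_le {z : ℂ} (hz : ‖z‖ < 1) :
    ‖deriv (herglotzIntegral μ) z‖ ≤ 2 / (1 - ‖z‖) ^ 2 * μ.real univ := by
  rw [(hasDerivAt_herglotzIntegral μ hz).deriv]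
  exact norm_integral_le_of_norm_le_const
    (ae_of_all _ fun x => norm_herglotzKernelDeriv_le x (by linarith) (by linarith))

theorem re_herglotzIntegral_nonneg {z : ℂ} (hz : ‖z‖ < 1) : 0 ≤ (herglotzIntegral μ z).re := by
  have hint : Integrable
      (fun x : UnitAddCircle => ((x.toCircle : ℂ) + z) / ((x.toCircle : ℂ) - z)) μ :=
    Integrable.of_bound (continuous_herglotzKernel hz).aestronglyMeasurable
      (2 / (1 - ‖z‖)) (ae_of_all _ fun x => norm_herglotzKernel_le x hz)
  rw [herglotzIntegral, ← RCLike.re_eq_complex_re, ← integral_re hint]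
  refine integral_nonneg fun x => ?_
  simp only [RCLike.re_eq_complex_re, Pi.zero_apply]
  rw [Complex.div_re, ← add_div]
  refine div_nonneg ?_ (Complex.normSq_nonneg _)
  have h1 : (x.toCircle : ℂ).re ^ 2 + (x.toCircle : ℂ).im ^ 2 = 1 := by
    have := Complex.sq_norm (x.toCircle : ℂ)
    rw [UnitAddCircle.norm_toCircle, Complex.normSq_apply] at this
    nlinarith
  have h2 : z.re ^ 2 + z.im ^ 2 < 1 := by
    have := Complex.sq_norm z
    rw [Complex.normSq_apply] at this
    nlinarith [norm_nonneg z]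
  simp only [Complex.add_re, Complex.sub_re, Complex.add_im, Complex.sub_im]
  nlinarith

theorem herglotzIntegral_zero (μ : Measure UnitAddCircle) : herglotzIntegral μ 0 = μ.real univ := by
  simp [herglotzIntegral]

end Herglotz

/-! ### Integration by parts on the circle. -/

/-- Integration by parts of an odd kernel against a measure on `[-1/2, 1/2)`. -/
theorem integral_odd_kernel (ν : Measure ℝ) [IsFiniteMeasure ν]
    (hν : ∀ᵐ x ∂ν, x ∈ Ico (-(1 / 2) : ℝ) (1 / 2)) {k k' : ℝ → ℝ}
    (hk : ∀ x, HasDerivAt k (k' x) x) (hk' : Continuous k') (hodd : ∀ x, k (-x) = -k x)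
    (hhalf : k (1 / 2) = 0) :
    ∫ x, k x ∂ν =
      -∫ y in (0 : ℝ)..(1 / 2), k' y * (ν.real (Ico 0 y) - ν.real (Ico (-y) 0)) := by
  -- Since `k` is odd and vanishes at `1 / 2`, `-k x` is `± ∫ k'` over `[|x|, 1 / 2]`, with the sign
  -- of `x`. These two regions encode that representation, and Fubini exchanges it with `ν`. The
  -- strict and weak inequalities are matched to the half-open intervals `Ico 0 y` and `Ico (-y) 0`.
  set s₁ : Set (ℝ × ℝ) := {p | 0 ≤ p.1 ∧ p.1 < p.2} with hs₁
  set s₂ : Set (ℝ × ℝ) := {p | -p.2 ≤ p.1 ∧ p.1 < 0} with hs₂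
  have ms₁ : MeasurableSet s₁ :=
    (measurableSet_le measurable_const measurable_fst).inter
      (measurableSet_lt measurable_fst measurable_snd)
  have ms₂ : MeasurableSet s₂ :=
    (measurableSet_le measurable_snd.neg measurable_fst).inter
      (measurableSet_lt measurable_fst measurable_const)
  set g : ℝ → ℝ → ℝ := fun x y =>
    k' y * (s₁.indicator 1 (x, y) - s₂.indicator 1 (x, y)) with hg
  have hgm : Measurable (Function.uncurry g) := by
    refine (hk'.measurable.comp measurable_snd).mul (Measurable.sub ?_ ?_)
    · exact measurable_one.indicator ms₁
    · exact measurable_one.indicator ms₂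
  obtain ⟨B, hB⟩ := (isCompact_Icc (a := (0 : ℝ)) (b := 1 / 2)).exists_bound_of_continuousOn
    hk'.continuousOn
  have hB0 : 0 ≤ B := (norm_nonneg _).trans (hB 0 (by norm_num))
  have hgi : Integrable (Function.uncurry g) (ν.prod (volume.restrict (Ioc (0 : ℝ) (1 / 2)))) := by
    refine Integrable.of_bound hgm.aestronglyMeasurable (B * 2) ?_
    have h2 : ∀ᵐ p : ℝ × ℝ ∂(ν.prod (volume.restrict (Ioc (0 : ℝ) (1 / 2)))),
        p.2 ∈ Ioc (0 : ℝ) (1 / 2) :=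
      Measure.quasiMeasurePreserving_snd.ae (ae_restrict_mem measurableSet_Ioc)
    filter_upwards [h2] with p hp
    simp only [Function.uncurry, hg, norm_mul]
    refine mul_le_mul (hB _ ⟨hp.1.le, hp.2⟩) ?_ (norm_nonneg _) hB0
    have e1 : ‖s₁.indicator (1 : ℝ × ℝ → ℝ) p‖ ≤ 1 := by
      by_cases h : p ∈ s₁ <;> simp [h]
    have e2 : ‖s₂.indicator (1 : ℝ × ℝ → ℝ) p‖ ≤ 1 := by
      by_cases h : p ∈ s₂ <;> simp [h]
    exact (norm_sub_le _ _).trans (by linarith)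
  have hint : ∀ a b : ℝ, ∫ y in a..b, k' y = k b - k a := fun a b =>
    intervalIntegral.integral_eq_sub_of_hasDerivAt (fun x _ => hk x) (hk'.intervalIntegrable a b)
  have hinner : ∀ x ∈ Ico (-(1 / 2) : ℝ) (1 / 2), ∫ y in Ioc (0 : ℝ) (1 / 2), g x y = -k x := by
    intro x hx
    rcases le_or_gt 0 x with h0 | h0
    · have : ∀ y, g x y = (Ioi x).indicator k' y := fun y => by
        have h2 : (x, y) ∉ s₂ := fun h => absurd h.2 (not_lt.2 h0)
        by_cases h : x < y
        · have h1 : (x, y) ∈ s₁ := ⟨h0, h⟩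
          simp [hg, h1, h2, h]
        · have h1 : (x, y) ∉ s₁ := fun h' => h h'.2
          simp [hg, h1, h2, h]
      simp_rw [this]
      rw [setIntegral_indicator measurableSet_Ioi]
      have : Ioc (0 : ℝ) (1 / 2) ∩ Ioi x = Ioc x (1 / 2) := by
        ext y; simp only [mem_inter_iff, mem_Ioc, mem_Ioi]
        constructor
        · rintro ⟨⟨-, h⟩, h'⟩; exact ⟨h', h⟩
        · rintro ⟨h, h'⟩; exact ⟨⟨by linarith, h'⟩, h⟩
      rw [this, ← intervalIntegral.integral_of_le hx.2.le, hint, hhalf, zero_sub]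
    · have : ∀ y, g x y = (Ici (-x)).indicator (fun y => -k' y) y := fun y => by
        have h2 : (x, y) ∉ s₁ := fun h => absurd h.1 (not_le.2 h0)
        by_cases h : -x ≤ y
        · have h1 : (x, y) ∈ s₂ := ⟨by change -y ≤ x; linarith, h0⟩
          simp [hg, h1, h2, h]
        · have h1 : (x, y) ∉ s₂ := fun h' => h (by have : -y ≤ x := h'.1; linarith)
          simp [hg, h1, h2, h]
      simp_rw [this]
      rw [setIntegral_indicator measurableSet_Ici]
      have : Ioc (0 : ℝ) (1 / 2) ∩ Ici (-x) = Icc (-x) (1 / 2) := by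
        ext y; simp only [mem_inter_iff, mem_Ioc, mem_Ici, mem_Icc]
        constructor
        · rintro ⟨⟨-, h⟩, h'⟩; exact ⟨h', h⟩
        · rintro ⟨h, h'⟩; exact ⟨⟨by linarith, h'⟩, h⟩
      rw [this, integral_Icc_eq_integral_Ioc,
        ← intervalIntegral.integral_of_le (by linarith [hx.1]), intervalIntegral.integral_neg,
        hint, hhalf, hodd]
      ring
  have houter : ∀ y, ∫ x, g x y ∂ν = k' y * (ν.real (Ico 0 y) - ν.real (Ico (-y) 0)) := by
    intro y
    have e1 : ∀ x, s₁.indicator (1 : ℝ × ℝ → ℝ) (x, y) = (Ico 0 y).indicator 1 x := fun x => rfl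
    have e2 : ∀ x, s₂.indicator (1 : ℝ × ℝ → ℝ) (x, y) = (Ico (-y) 0).indicator 1 x := fun x => rfl
    simp only [hg, e1, e2]
    rw [integral_const_mul, integral_sub]
    · rw [integral_indicator_one measurableSet_Ico, integral_indicator_one measurableSet_Ico]
    · exact (integrable_const (1 : ℝ)).indicator measurableSet_Ico
    · exact (integrable_const (1 : ℝ)).indicator measurableSet_Ico
  have hswap := integral_integral_swap hgi
  rw [intervalIntegral.integral_of_le (by norm_num)]
  simp_rw [houter] at hswap
  rw [← hswap, ← integral_neg]
  refine integral_congr_ae ?_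
  filter_upwards [hν] with x hx
  rw [hinner x hx, neg_neg]

/-- The coordinate in `[-1/2, 1/2)` of a point of the circle relative to `a`. -/
noncomputable def circleCoord (a : ℝ) (x : UnitAddCircle) : ℝ :=
  (AddCircle.equivIco 1 (a - 1 / 2) x : ℝ) - a

theorem measurable_circleCoord (a : ℝ) : Measurable (circleCoord a) :=
  (measurable_subtype_coe.comp
    (AddCircle.measurableEquivIco (1 : ℝ) (a - 1 / 2)).measurable).sub_const a

theorem circleCoord_mem (a : ℝ) (x : UnitAddCircle) :
    circleCoord a x ∈ Ico (-(1 / 2) : ℝ) (1 / 2) := by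
  have h := (AddCircle.equivIco 1 (a - 1 / 2) x).2
  unfold circleCoord
  constructor <;> linarith [h.1, h.2]

theorem coe_add_circleCoord (a : ℝ) (x : UnitAddCircle) :
    ((a + circleCoord a x : ℝ) : UnitAddCircle) = x := by
  unfold circleCoord
  rw [add_sub_cancel]
  exact (AddCircle.equivIco 1 (a - 1 / 2)).symm_apply_apply x

theorem circleCoord_coe {a x : ℝ} (hx : x ∈ Ico (-(1 / 2) : ℝ) (1 / 2)) :
    circleCoord a ((a + x : ℝ) : UnitAddCircle) = x := by
  have h : a + x ∈ Ico (a - 1 / 2) (a - 1 / 2 + 1) := by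
    constructor <;> linarith [hx.1, hx.2]
  unfold circleCoord
  rw [AddCircle.equivIco_coe_eq h]
  ring

theorem circleCoord_preimage_Ico {a b c : ℝ} (hb : -(1 / 2) ≤ b) (hc : c ≤ 1 / 2) :
    circleCoord a ⁻¹' Ico b c = circleArc (a + b) (c - b) := by
  ext x
  constructor
  · intro hx
    refine ⟨a + circleCoord a x, ⟨?_, ?_⟩, coe_add_circleCoord a x⟩
    · linarith [hx.1]
    · linarith [hx.2]
  · rintro ⟨y, hy, rfl⟩
    have h : y - a ∈ Ico (-(1 / 2) : ℝ) (1 / 2) := by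
      constructor <;> linarith [hy.1, hy.2]
    have := circleCoord_coe (a := a) h
    rw [add_sub_cancel] at this
    simp only [mem_preimage, this]
    constructor <;> linarith [hy.1, hy.2]

theorem abs_measureReal_arc_sub_le {φ : ℝ → ℝ} {μ : Measure UnitAddCircle} [IsFiniteMeasure μ]
    {C : ℝ} (hC : ∀ δ ∈ Ioc (0 : ℝ) 1, modulusOfSmoothness μ δ ≤ C * δ * φ δ) (a : ℝ) {h : ℝ}
    (h0 : 0 < h) (h1 : h ≤ 1 / 2) :
    |μ.real (circleArc a h) - μ.real (circleArc (a + h) h)| ≤ C * h * φ h :=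
  (le_csSup (bddAbove_arcDifferences μ h) ⟨a, h, h0, le_rfl, by linarith, rfl⟩).trans
    (hC h ⟨h0, by linarith⟩)

/-- The line version applied to the image of `μ` under the coordinate centred at `a`. The two arcs
on the right are adjacent at `a` and of equal length, which is what the modulus of smoothness
measures. -/
theorem integral_odd_kernel_circle (μ : Measure UnitAddCircle) [IsFiniteMeasure μ] (a : ℝ)
    {k k' : ℝ → ℝ} (hk : ∀ x, HasDerivAt k (k' x) x) (hk' : Continuous k')
    (hodd : ∀ x, k (-x) = -k x) (hhalf : k (1 / 2) = 0) :
    ∫ x, k (circleCoord a x) ∂μ = -∫ y in (0 : ℝ)..(1 / 2),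
      k' y * (μ.real (circleArc a y) - μ.real (circleArc (a - y) y)) := by
  have hkc : Continuous k := continuous_iff_continuousAt.2 fun x => (hk x).continuousAt
  have h := integral_odd_kernel (μ.map (circleCoord a))
    ((ae_map_iff (measurable_circleCoord a).aemeasurable measurableSet_Ico).2
      (ae_of_all _ fun x => circleCoord_mem a x)) hk hk' hodd hhalf
  rw [integral_map (measurable_circleCoord a).aemeasurable hkc.aestronglyMeasurable] at h
  rw [h, intervalIntegral.integral_of_le (by norm_num), intervalIntegral.integral_of_le (by norm_num)]
  congr 1
  refine setIntegral_congr_fun measurableSet_Ioc fun y hy => ?_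
  rw [map_measureReal_apply (measurable_circleCoord a) measurableSet_Ico,
    map_measureReal_apply (measurable_circleCoord a) measurableSet_Ico,
    circleCoord_preimage_Ico (by norm_num) hy.2,
    circleCoord_preimage_Ico (by linarith [hy.2]) (by norm_num), add_zero, sub_zero,
    zero_sub, neg_neg, ← sub_eq_add_neg]

/-! ### Estimates for the differentiated Poisson kernel. -/

/-- The angular derivative of the Poisson kernel, up to a constant factor. -/
noncomputable def oddPoissonKernel (r x : ℝ) : ℝ :=
  (1 - r ^ 2) * Real.sin (2 * Real.pi * x) / (1 - 2 * r * Real.cos (2 * Real.pi * x) + r ^ 2) ^ 2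

/-- The derivative of `oddPoissonKernel r`. -/
noncomputable def oddPoissonKernelDeriv (r x : ℝ) : ℝ :=
  (1 - r ^ 2) * (2 * Real.pi * Real.cos (2 * Real.pi * x) *
      (1 - 2 * r * Real.cos (2 * Real.pi * x) + r ^ 2) -
    8 * Real.pi * r * Real.sin (2 * Real.pi * x) ^ 2) /
    (1 - 2 * r * Real.cos (2 * Real.pi * x) + r ^ 2) ^ 3

theorem poissonDenominator_pos {r : ℝ} (h0 : 0 ≤ r) (h1 : r < 1) (y : ℝ) :
    0 < 1 - 2 * r * Real.cos y + r ^ 2 := by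
  nlinarith [Real.cos_le_one y, mul_nonneg h0 (sub_nonneg.2 (Real.cos_le_one y)),
    mul_pos (sub_pos.2 h1) (sub_pos.2 h1)]

theorem hasDerivAt_oddPoissonKernel {r : ℝ} (h0 : 0 ≤ r) (h1 : r < 1) (x : ℝ) :
    HasDerivAt (oddPoissonKernel r) (oddPoissonKernelDeriv r x) x := by
  have hD := poissonDenominator_pos h0 h1 (2 * Real.pi * x)
  have hl : HasDerivAt (fun x : ℝ => 2 * Real.pi * x) (2 * Real.pi) x := by
    simpa using (hasDerivAt_id x).const_mul (2 * Real.pi)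
  have h := (hl.sin.const_mul (1 - r ^ 2)).div
    ((((hl.cos.const_mul (2 * r)).const_sub 1).add_const (r ^ 2)).pow 2)
    (pow_ne_zero 2 hD.ne')
  refine h.congr_deriv ?_
  unfold oddPoissonKernelDeriv
  simp only [Pi.pow_apply]
  generalize 1 - 2 * r * Real.cos (2 * Real.pi * x) + r ^ 2 = D at hD
  rw [div_eq_div_iff (by positivity) (by positivity)]
  push_cast
  ring

theorem continuous_oddPoissonKernelDeriv {r : ℝ} (h0 : 0 ≤ r) (h1 : r < 1) :
    Continuous (oddPoissonKernelDeriv r) := by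
  unfold oddPoissonKernelDeriv
  refine Continuous.div (by fun_prop) (by fun_prop) fun x => ?_
  exact pow_ne_zero 3 (poissonDenominator_pos h0 h1 _).ne'

theorem oddPoissonKernel_neg (r x : ℝ) : oddPoissonKernel r (-x) = -oddPoissonKernel r x := by
  unfold oddPoissonKernel
  rw [mul_neg, Real.sin_neg, Real.cos_neg]
  ring

theorem oddPoissonKernel_half (r : ℝ) : oddPoissonKernel r (1 / 2) = 0 := by
  unfold oddPoissonKernel
  rw [show 2 * Real.pi * (1 / 2) = Real.pi by ring]
  simp

/-- The denominator is `(1 - r)² + 4 r sin² (π y)`, and Jordan's inequality gives `sin (π y) ≥ 2 y`.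
For `r ≤ 1 / 2` the first term suffices, because then `y ≤ 1 - r`. -/
theorem le_poissonDenominator {r y : ℝ} (h0 : 0 ≤ r) (h1 : r < 1) (hy0 : 0 ≤ y)
    (hy1 : y ≤ 1 / 2) :
    ((1 - r) ^ 2 + y ^ 2) / 2 ≤ 1 - 2 * r * Real.cos (2 * Real.pi * y) + r ^ 2 := by
  have hs : 2 * y ≤ Real.sin (Real.pi * y) := by
    have h := Real.mul_le_sin (x := Real.pi * y) (by positivity)
      (by nlinarith [Real.pi_pos])
    rwa [show 2 / Real.pi * (Real.pi * y) = 2 * y by field_simp] at h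
  have hc : Real.cos (2 * Real.pi * y) = 1 - 2 * Real.sin (Real.pi * y) ^ 2 := by
    rw [mul_assoc, Real.cos_two_mul, Real.cos_sq']
    ring
  have hs2 : 4 * y ^ 2 ≤ Real.sin (Real.pi * y) ^ 2 := by nlinarith
  rw [hc]
  have h3 := mul_le_mul_of_nonneg_left hs2 h0
  rcases le_total r (1 / 2) with h | h
  · have : y ^ 2 ≤ (1 - r) ^ 2 := by nlinarith
    nlinarith [mul_nonneg h0 (sq_nonneg y)]
  · nlinarith [mul_nonneg (sub_nonneg.2 h) (sq_nonneg y), sq_nonneg (1 - r), sq_nonneg y]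

/-- With `D` the Poisson denominator, `r sin² ≤ D` because `sin² ≤ 2 (1 - cos)` and `D = (1 - r)² +
2 r (1 - cos)`. Hence the bracket in the numerator is `O(D)`, one power of `D` cancels, and the
lower bound for `D` applies. -/
theorem abs_oddPoissonKernelDeriv_le {r y : ℝ} (h0 : 0 ≤ r) (h1 : r < 1) (hy0 : 0 ≤ y)
    (hy1 : y ≤ 1 / 2) :
    |oddPoissonKernelDeriv r y| ≤ 80 * Real.pi * (1 - r) / ((1 - r) ^ 2 + y ^ 2) ^ 2 := by
  have hD := poissonDenominator_pos h0 h1 (2 * Real.pi * y)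
  have hle := le_poissonDenominator h0 h1 hy0 hy1
  unfold oddPoissonKernelDeriv
  set D := 1 - 2 * r * Real.cos (2 * Real.pi * y) + r ^ 2 with hDdef
  have hsq := Real.sin_sq_add_cos_sq (2 * Real.pi * y)
  set s := Real.sin (2 * Real.pi * y)
  set c := Real.cos (2 * Real.pi * y)
  have hc1 : c ≤ 1 := Real.cos_le_one _
  have hc2 : -1 ≤ c := Real.neg_one_le_cos _
  have hpi := Real.pi_pos
  have hrs : r * s ^ 2 ≤ D := by
    have : s ^ 2 ≤ 2 * (1 - c) := by nlinarith
    nlinarith [mul_le_mul_of_nonneg_left this h0, sq_nonneg (1 - r)]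
  have hnum : |2 * Real.pi * c * D - 8 * Real.pi * r * s ^ 2| ≤ 10 * Real.pi * D := by
    have e1 : c * D ≤ D := by nlinarith
    have e2 : -D ≤ c * D := by nlinarith
    have e3 : 0 ≤ r * s ^ 2 := by positivity
    rw [abs_le]
    constructor
    · nlinarith [mul_le_mul_of_nonneg_left e2 hpi.le, mul_le_mul_of_nonneg_left hrs hpi.le]
    · nlinarith [mul_le_mul_of_nonneg_left e1 hpi.le, mul_nonneg hpi.le e3, mul_pos hpi hD]
  have ht : 0 < (1 - r) ^ 2 + y ^ 2 := by
    have : 0 < (1 - r) ^ 2 := pow_pos (by linarith) 2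
    positivity
  rw [abs_div, abs_mul, abs_of_nonneg (show 0 ≤ 1 - r ^ 2 by nlinarith), abs_of_pos (pow_pos hD 3),
    div_le_div_iff₀ (pow_pos hD 3) (pow_pos ht 2)]
  have hsqle : ((1 - r) ^ 2 + y ^ 2) ^ 2 ≤ 4 * D ^ 2 := by nlinarith
  calc (1 - r ^ 2) * |2 * Real.pi * c * D - 8 * Real.pi * r * s ^ 2| * ((1 - r) ^ 2 + y ^ 2) ^ 2
      ≤ (2 * (1 - r)) * (10 * Real.pi * D) * (4 * D ^ 2) := by
        gcongr
        nlinarith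
    _ = 80 * Real.pi * (1 - r) * D ^ 3 := by ring

theorem im_div_sub_sq {r c s : ℝ} (hcs : s ^ 2 + c ^ 2 = 1) :
    (2 * ((c + s * Complex.I) * r) / ((c + s * Complex.I) - r) ^ 2 : ℂ).im =
      -(2 * r * ((1 - r ^ 2) * s / (1 - 2 * r * c + r ^ 2) ^ 2)) := by
  have hn : Complex.normSq (((c + s * Complex.I) - r : ℂ) ^ 2) = (1 - 2 * r * c + r ^ 2) ^ 2 := by
    rw [map_pow]
    congr 1
    rw [Complex.normSq_apply]
    simp
    linear_combination hcs
  rw [Complex.div_im, hn, ← sub_div, ← mul_div_assoc, ← neg_div]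
  congr 1
  simp [pow_two]
  linear_combination (-2 * r * s) * hcs

/-- The expression `2 ζ z / (ζ - z)²` is homogeneous of degree zero in `(ζ, z)`, so a rotation
reduces to `z = r`. -/
theorem kernel_im_eq (a r : ℝ) (x : UnitAddCircle) :
    (2 * ((x.toCircle : ℂ) * (r * Complex.exp (2 * Real.pi * a * Complex.I))) /
      ((x.toCircle : ℂ) - r * Complex.exp (2 * Real.pi * a * Complex.I)) ^ 2).im =
      -(2 * r * oddPoissonKernel r (circleCoord a x)) := by
  set c := circleCoord a x with hc
  have hx : (x.toCircle : ℂ) = Complex.exp (2 * Real.pi * a * Complex.I) *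
      Complex.exp ((2 * Real.pi * c : ℝ) * Complex.I) := by
    rw [← coe_add_circleCoord a x, AddCircle.toCircle_apply_mk, Circle.coe_exp, ← Complex.exp_add]
    congr 1
    push_cast
    ring
  have he := Complex.exp_ne_zero (2 * Real.pi * a * Complex.I)
  rw [hx, Complex.exp_mul_I ((2 * Real.pi * c : ℝ) : ℂ), ← Complex.ofReal_cos, ← Complex.ofReal_sin]
  unfold oddPoissonKernel
  rw [← im_div_sub_sq (Real.sin_sq_add_cos_sq (2 * Real.pi * c))]
  congr 1
  set E := Complex.exp (2 * Real.pi * a * Complex.I)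
  rw [show ∀ w : ℂ, E * w - r * E = E * (w - r) from fun w => by ring, mul_pow,
    show ∀ w : ℂ, 2 * (E * w * (r * E)) = E ^ 2 * (2 * (w * r)) from fun w => by ring,
    mul_div_mul_left _ _ (pow_ne_zero 2 he)]

theorem integral_inv_sq_add_sq_le {t : ℝ} (ht : 0 < t) :
    ∫ y in (0 : ℝ)..(1 / 2), 1 / (t ^ 2 + y ^ 2) ≤ 2 / t := by
  have hd : ∀ y ∈ uIcc (0 : ℝ) (1 / 2),
      HasDerivAt (fun y => Real.arctan (y / t) / t) (1 / (t ^ 2 + y ^ 2)) y := fun y _ => by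
    refine (((hasDerivAt_id y).div_const t).arctan.div_const t).congr_deriv ?_
    simp only [id]
    have : t ^ 2 + y ^ 2 ≠ 0 := by positivity
    field_simp
  have hc : Continuous fun y : ℝ => 1 / (t ^ 2 + y ^ 2) :=
    continuous_const.div (by fun_prop) fun y => by positivity
  rw [intervalIntegral.integral_eq_sub_of_hasDerivAt hd (hc.intervalIntegrable _ _)]
  simp only [zero_div, Real.arctan_zero, sub_zero]
  gcongr
  linarith [Real.arctan_lt_pi_div_two (1 / 2 / t), Real.pi_lt_four]

/-! ### Growth of the derivative of the Herglotz integral. -/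

theorem le_mul_rpow_of_almostDecreasing {φ : ℝ → ℝ} {β : ℝ}
    (hφ_pos : ∀ t ∈ Ioc (0 : ℝ) 1, 0 < φ t)
    (hφ_dec : AlmostDecreasing (fun t => φ t / t ^ β)) :
    ∃ K : ℝ, 1 ≤ K ∧ ∀ t s : ℝ, 0 < t → t ≤ s → s ≤ 1 → φ s ≤ K * φ t * (s / t) ^ β := by
  obtain ⟨c, hc, h⟩ := hφ_dec
  refine ⟨max 1 c⁻¹, le_max_left _ _, fun t s ht hts hs => ?_⟩
  have hpos := hφ_pos t ⟨ht, hts.trans hs⟩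
  rcases hts.eq_or_lt with rfl | hlt
  · rw [div_self ht.ne', Real.one_rpow, mul_one]
    exact le_mul_of_one_le_left hpos.le (le_max_left _ _)
  · have hs0 := ht.trans hlt
    have h' := h t ⟨ht, hts.trans hs⟩ s ⟨hs0, hs⟩ hlt
    have e : φ s ≤ c⁻¹ * φ t * (s / t) ^ β := by
      rw [Real.div_rpow hs0.le ht.le]
      have hsb := Real.rpow_pos_of_pos hs0 β
      have htb := Real.rpow_pos_of_pos ht β
      simp only at h'
      rw [← mul_div_assoc, div_le_div_iff₀ hsb htb] at h'
      rw [← mul_div_assoc, le_div_iff₀ htb, mul_assoc, inv_mul_eq_div, le_div_iff₀ hc]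
      linarith
    refine e.trans ?_
    gcongr
    exact le_max_right _ _

/-- Up to sign, `Im (z H')` is the angular derivative of `Re H`, the Poisson integral of `μ`; its
kernel is odd about the direction of `z`, so smoothness enters by integration by parts. -/
theorem abs_im_mul_deriv_herglotzIntegral_le {φ : ℝ → ℝ} {β : ℝ}
    (hφ_pos : ∀ t ∈ Ioc (0 : ℝ) 1, 0 < φ t) (hφ_mono : MonotoneOn φ (Ioc (0 : ℝ) 1))
    (hβ1 : β ≤ 1) (hφ_dec : AlmostDecreasing (fun t => φ t / t ^ β))
    (μ : Measure UnitAddCircle) [IsFiniteMeasure μ] (hμ : IsSmoothMeasure φ μ) :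
    ∃ C : ℝ, 0 < C ∧ ∀ z : ℂ, ‖z‖ < 1 →
      |(z * deriv (herglotzIntegral μ) z).im| ≤ C * (φ (1 - ‖z‖) / (1 - ‖z‖)) := by
  obtain ⟨C, hC, hsm⟩ := hμ
  obtain ⟨K, hK1, hK⟩ := le_mul_rpow_of_almostDecreasing hφ_pos hφ_dec
  have hpi := Real.pi_pos
  refine ⟨320 * Real.pi * C * K, by positivity, fun z hz => ?_⟩
  set r := ‖z‖ with hr
  have hr0 : 0 ≤ r := norm_nonneg z
  set t := 1 - r with htdef
  have ht : 0 < t := by linarith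
  have hφt : 0 < φ t := hφ_pos t ⟨ht, by linarith⟩
  set a := z.arg / (2 * Real.pi) with ha
  have hza : z = r * Complex.exp (2 * Real.pi * a * Complex.I) := by
    have : (2 * Real.pi * a : ℂ) = z.arg := by
      rw [ha]
      push_cast
      field_simp
    rw [this, hr, Complex.norm_mul_exp_arg_mul_I]
  have heq : (z * deriv (herglotzIntegral μ) z).im =
      ∫ x, -(2 * r * oddPoissonKernel r (circleCoord a x)) ∂μ := by
    rw [(hasDerivAt_herglotzIntegral μ hz).deriv, ← integral_const_mul]
    have hint : Integrable (fun x : UnitAddCircle =>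
        z * (2 * (x.toCircle : ℂ) / ((x.toCircle : ℂ) - z) ^ 2)) μ :=
      (Integrable.of_bound (continuous_herglotzKernelDeriv hz).aestronglyMeasurable _
        (ae_of_all _ fun x => norm_herglotzKernelDeriv_le x ht (by linarith))).const_mul z
    rw [← RCLike.im_eq_complex_im, ← integral_im hint]
    refine integral_congr_ae (ae_of_all _ fun x => ?_)
    simp only [RCLike.im_eq_complex_im]
    rw [← kernel_im_eq, ← hza]
    congr 1
    ring
  rw [heq, integral_neg, integral_const_mul, integral_odd_kernel_circle μ a
    (hasDerivAt_oddPoissonKernel hr0 hz) (continuous_oddPoissonKernelDeriv hr0 hz)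
    (oddPoissonKernel_neg r) (oddPoissonKernel_half r), mul_neg, neg_neg, abs_mul,
    abs_of_nonneg (by positivity : 0 ≤ 2 * r)]
  have hbound : |∫ y in (0 : ℝ)..(1 / 2), oddPoissonKernelDeriv r y *
      (μ.real (circleArc a y) - μ.real (circleArc (a - y) y))| ≤
      ∫ y in (0 : ℝ)..(1 / 2), 80 * Real.pi * C * K * φ t * (1 / (t ^ 2 + y ^ 2)) := by
    rw [← Real.norm_eq_abs]
    refine intervalIntegral.norm_integral_le_of_norm_le (by norm_num) (ae_of_all _ fun y hy => ?_) ?_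
    · have hy0 : 0 < y := hy.1
      have hy1 : y ≤ 1 / 2 := hy.2
      have h1 := abs_oddPoissonKernelDeriv_le hr0 hz hy0.le hy1
      have h2 := abs_measureReal_arc_sub_le hsm (a - y) hy0 hy1
      rw [sub_add_cancel, abs_sub_comm] at h2
      -- Monotonicity handles `y ≤ t`, almost decrease handles `y ≥ t`. The form of the bound
      -- cancels one factor `t² + y²` of the kernel estimate, leaving an arctangent integral.
      have h3 : y * φ y ≤ K * φ t * ((t ^ 2 + y ^ 2) / t) := by
        rcases le_total y t with h | h
        · have e1 : φ y ≤ φ t := hφ_mono ⟨hy0, by linarith⟩ ⟨ht, by linarith⟩ h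
          calc y * φ y ≤ t * φ t := by
                  have := hφ_pos y ⟨hy0, by linarith⟩
                  gcongr
            _ ≤ K * φ t * t := by nlinarith [mul_pos ht hφt]
            _ ≤ _ := by
                gcongr
                rw [le_div_iff₀ ht]
                nlinarith
        · have e1 := hK t y ht h (by linarith)
          have e2 : (y / t) ^ β ≤ y / t := by
            conv_rhs => rw [← Real.rpow_one (y / t)]
            exact Real.rpow_le_rpow_of_exponent_le ((one_le_div ht).2 h) hβ1
          calc y * φ y ≤ y * (K * φ t * (y / t)) := by
                  gcongr
                  refine e1.trans ?_
                  gcongr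
            _ = K * φ t * (y ^ 2 / t) := by ring
            _ ≤ _ := by
                gcongr
                nlinarith
      rw [norm_mul, Real.norm_eq_abs, Real.norm_eq_abs]
      have hpos : 0 < t ^ 2 + y ^ 2 := by positivity
      calc _ ≤ (80 * Real.pi * t / (t ^ 2 + y ^ 2) ^ 2) * (C * (y * φ y)) := by
              refine mul_le_mul h1 (by linarith) (abs_nonneg _) (by positivity)
        _ ≤ (80 * Real.pi * t / (t ^ 2 + y ^ 2) ^ 2) * (C * (K * φ t * ((t ^ 2 + y ^ 2) / t))) := by
              gcongr
        _ = _ := by field_simp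
    · refine Continuous.intervalIntegrable ?_ _ _
      exact continuous_const.mul (continuous_const.div (by fun_prop) fun y => by positivity)
  rw [intervalIntegral.integral_const_mul] at hbound
  calc _ ≤ 2 * 1 * (80 * Real.pi * C * K * φ t * (2 / t)) := by
        gcongr
        refine hbound.trans ?_
        gcongr
        exact integral_inv_sq_add_sq_le ht
    _ = _ := by ring

/-- Cauchy's estimate with a bound for the imaginary part only. -/
theorem norm_deriv_le_of_abs_im_le {f : ℂ → ℂ} {c : ℂ} {R M : ℝ} (hR : 0 < R) (hM : 0 < M)
    (hf : ∀ w ∈ Metric.closedBall c R, DifferentiableAt ℂ f w)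
    (him : ∀ w ∈ Metric.closedBall c R, |(f w).im| ≤ M) :
    ‖deriv f c‖ ≤ Real.exp 2 * M / R := by
  -- On the closed disc `exp (-1) ≤ |E| ≤ exp 1`. Cauchy's estimate for `E`, divided by `|E c|`,
  -- bounds `f'` and produces the factor `exp 2`.
  set E : ℂ → ℂ := fun w => Complex.exp (-Complex.I / M * f w) with hE
  have hre : ∀ w, (-Complex.I / M * f w).re = (f w).im / M := fun w => by
    rw [show -Complex.I / M * f w = ((M⁻¹ : ℝ) : ℂ) * (-Complex.I * f w) by
      push_cast; ring, Complex.re_ofReal_mul]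
    simp
    ring
  have hEd : ∀ w ∈ Metric.closedBall c R,
      HasDerivAt E (E w * (-Complex.I / M * deriv f w)) w := fun w hw =>
    ((hf w hw).hasDerivAt.const_mul _).cexp
  have hcl : DiffContOnCl ℂ E (Metric.ball c R) :=
    DifferentiableOn.diffContOnCl fun w hw =>
      (hEd w (Metric.closure_ball_subset_closedBall hw)).differentiableAt.differentiableWithinAt
  have hb : ∀ w ∈ Metric.sphere c R, ‖E w‖ ≤ Real.exp 1 := fun w hw => by
    rw [Complex.norm_exp, hre]
    refine Real.exp_le_exp.2 ((div_le_one hM).2 ?_)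
    exact (le_abs_self _).trans (him w (Metric.sphere_subset_closedBall hw))
  have hc := Metric.mem_closedBall_self (x := c) hR.le
  have h := Complex.norm_deriv_le_of_forall_mem_sphere_norm_le hR hcl hb
  rw [(hEd c hc).deriv, norm_mul, norm_mul, norm_div, norm_neg, Complex.norm_I,
    Complex.norm_real, Real.norm_of_nonneg hM.le] at h
  have hlow : Real.exp (-1) ≤ ‖E c‖ := by
    rw [Complex.norm_exp, hre]
    refine Real.exp_le_exp.2 ?_
    rw [le_div_iff₀ hM]
    linarith [neg_le_of_abs_le (him c hc)]
  have h' : Real.exp (-1) * (1 / M * ‖deriv f c‖) ≤ Real.exp 1 / R :=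
    (mul_le_mul_of_nonneg_right hlow (by positivity)).trans h
  have hexp : Real.exp 2 = Real.exp 1 * Real.exp 1 := by rw [← Real.exp_add]; norm_num
  rw [Real.exp_neg] at h'
  have h1 := Real.exp_pos 1
  calc ‖deriv f c‖ = Real.exp 1 * M * ((Real.exp 1)⁻¹ * (1 / M * ‖deriv f c‖)) := by
        field_simp
    _ ≤ Real.exp 1 * M * (Real.exp 1 / R) := by gcongr
    _ = _ := by rw [hexp]; ring

theorem differentiableAt_deriv_herglotzIntegral (μ : Measure UnitAddCircle) [IsFiniteMeasure μ]
    {z : ℂ} (hz : ‖z‖ < 1) : DifferentiableAt ℂ (deriv (herglotzIntegral μ)) z :=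
  ((differentiableOn_herglotzIntegral μ).deriv Metric.isOpen_ball).differentiableAt
    (Metric.isOpen_ball.mem_nhds (by simpa using hz))

/-- The growth of the derivative of the Herglotz integral of a smooth measure. -/
theorem norm_deriv_herglotzIntegral_le_of_isSmoothMeasure {φ : ℝ → ℝ} {β : ℝ}
    (hφ_pos : ∀ t ∈ Ioc (0 : ℝ) 1, 0 < φ t) (hφ_mono : MonotoneOn φ (Ioc (0 : ℝ) 1))
    (hβ1 : β < 1) (hφ_dec : AlmostDecreasing (fun t => φ t / t ^ β))
    (μ : Measure UnitAddCircle) [IsFiniteMeasure μ] (hμ : IsSmoothMeasure φ μ) :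
    ∃ C : ℝ, 0 < C ∧ ∀ z : ℂ, ‖z‖ < 1 →
      ‖deriv (herglotzIntegral μ) z‖ ≤ C * (φ (1 - ‖z‖) / (1 - ‖z‖)) := by
  obtain ⟨C, hC, him⟩ :=
    abs_im_mul_deriv_herglotzIntegral_le hφ_pos hφ_mono hβ1.le hφ_dec μ hμ
  obtain ⟨K, hK1, hK⟩ := le_mul_rpow_of_almostDecreasing hφ_pos hφ_dec
  set Q : ℂ → ℂ := fun z => z * deriv (herglotzIntegral μ) z with hQ
  have hQd : ∀ z, ‖z‖ < 1 → DifferentiableAt ℂ Q z := fun z hz =>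
    differentiableAt_id.mul (differentiableAt_deriv_herglotzIntegral μ hz)
  -- The factor `4` comes from applying the Cauchy estimate on discs of radius `t / 2`, where the
  -- imaginary part is at most `2 C K φ(t) / t`.
  set A := 4 * C * K * Real.exp 2 with hA
  have hApos : 0 < A := by positivity
  have hQ' : ∀ z, ‖z‖ < 1 → ‖deriv Q z‖ ≤ A * (φ (1 - ‖z‖) / (1 - ‖z‖) ^ 2) := by
    intro z hz
    set t := 1 - ‖z‖ with ht_def
    have ht : 0 < t := by linarith
    have ht1 : t ≤ 1 := by linarith [norm_nonneg z]
    have hφt := hφ_pos t ⟨ht, ht1⟩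
    have hw : ∀ w ∈ Metric.closedBall z (t / 2), t / 2 ≤ 1 - ‖w‖ := fun w hw => by
      rw [mem_closedBall_iff_norm] at hw
      have := norm_le_norm_add_norm_sub' w z
      linarith
    refine (norm_deriv_le_of_abs_im_le (M := 2 * C * K * (φ t / t)) (half_pos ht) (by positivity)
      (fun w h => hQd w (by linarith [hw w h])) fun w h => ?_).trans_eq ?_
    · have hs := hw w h
      have hs0 : 0 < 1 - ‖w‖ := by linarith
      have hs1 : 1 - ‖w‖ ≤ 1 := by linarith [norm_nonneg w]
      refine (him w (by linarith)).trans ?_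
      set s := 1 - ‖w‖
      have h1 : φ s ≤ K * φ (t / 2) * (s / (t / 2)) := by
        refine (hK (t / 2) s (by linarith) hs hs1).trans ?_
        have h2 : (s / (t / 2)) ^ β ≤ s / (t / 2) := by
          conv_rhs => rw [← Real.rpow_one (s / (t / 2))]
          exact Real.rpow_le_rpow_of_exponent_le ((one_le_div (by linarith)).2 hs) hβ1.le
        have := hφ_pos (t / 2) ⟨by linarith, by linarith⟩
        gcongr
      have h3 : φ (t / 2) ≤ φ t :=
        hφ_mono ⟨by linarith, by linarith⟩ ⟨ht, ht1⟩ (by linarith)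
      calc C * (φ s / s) ≤ C * (K * φ t * (s / (t / 2)) / s) := by
            gcongr
            refine h1.trans ?_
            gcongr
        _ = _ := by field_simp
    · rw [hA]
      field_simp
      ring
  have hQb : ∀ z, ‖z‖ < 1 → ‖Q z‖ ≤ A * K / (1 - β) * (φ (1 - ‖z‖) / (1 - ‖z‖)) := by
    intro z hz
    rcases eq_or_ne z 0 with rfl | hz0
    · have := hφ_pos 1 (by simp)
      have hb : 0 < 1 - β := by linarith
      simp only [hQ, zero_mul, norm_zero, sub_zero, div_one]
      positivity
    set r := ‖z‖ with hr
    have hr0 : 0 < r := norm_pos_iff.2 hz0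
    set t := 1 - r with ht_def
    have ht : 0 < t := by linarith
    have hφt := hφ_pos t ⟨ht, by linarith⟩
    set u : ℂ := z / r with hu
    have hun : ‖u‖ = 1 := by
      rw [hu, norm_div, Complex.norm_real, Real.norm_of_nonneg hr0.le, ← hr, div_self hr0.ne']
    have hzu : (r : ℂ) * u = z := by
      rw [hu, mul_div_cancel₀]
      exact_mod_cast hr0.ne'
    have hnorm : ∀ τ : ℝ, 0 ≤ τ → ‖(τ : ℂ) * u‖ = τ := fun τ hτ => by
      rw [norm_mul, hun, mul_one, Complex.norm_real, Real.norm_of_nonneg hτ]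
    have hfd : ∀ τ ∈ Icc 0 r, HasDerivAt (fun τ : ℝ => Q (τ * u)) (deriv Q (τ * u) * u) τ := by
      intro τ hτ
      have h1 : HasDerivAt Q (deriv Q (τ * u)) (τ * u) :=
        (hQd _ (by rw [hnorm τ hτ.1]; linarith [hτ.2])).hasDerivAt
      have h2 : HasDerivAt (fun τ : ℂ => τ * u) u τ := by
        simpa using (hasDerivAt_id (τ : ℂ)).mul_const u
      exact (HasDerivAt.comp (τ : ℂ) h1 h2).comp_ofReal
    -- Almost decrease compares `φ (1 - τ)` with `φ t`, which majorizes the radial derivative of `Q`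
    -- by `D (1 - τ) ^ (β - 2)`. As `Q 0 = 0`, its primitive bounds `Q`; here `β < 1` is essential,
    -- since `β = 1` would give a logarithm.
    set D := A * K * φ t * t ^ (-β) with hD
    have hDpos : 0 < D := by positivity
    have hb : 0 < 1 - β := by linarith
    have hBd : ∀ τ : ℝ, τ < 1 → HasDerivAt (fun τ : ℝ => D / (1 - β) * (1 - τ) ^ (β - 1))
        (D * (1 - τ) ^ (β - 2)) τ := by
      intro τ hτ
      have h1 := (((hasDerivAt_id τ).const_sub 1).rpow_const (p := β - 1)
        (Or.inl (by simp only [id]; linarith))).const_mul (D / (1 - β))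
      refine h1.congr_deriv ?_
      simp only [id]
      rw [show β - 1 - 1 = β - 2 by ring]
      field_simp
      ring
    have hcont : ContinuousOn (fun τ : ℝ => D / (1 - β) * (1 - τ) ^ (β - 1)) (Icc 0 r) :=
      fun τ hτ => (hBd τ (by linarith [hτ.2])).continuousAt.continuousWithinAt
    have key := image_norm_le_of_norm_deriv_right_le_deriv_boundary'
      (f := fun τ : ℝ => Q (τ * u)) (f' := fun τ : ℝ => deriv Q (τ * u) * u) (a := 0) (b := r)
      (fun τ hτ => (hfd τ hτ).continuousAt.continuousWithinAt)
      (fun τ hτ => (hfd τ (Ico_subset_Icc_self hτ)).hasDerivWithinAt)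
      (B := fun τ : ℝ => D / (1 - β) * (1 - τ) ^ (β - 1)) (B' := fun τ => D * (1 - τ) ^ (β - 2))
      (by simp [hQ]; positivity) hcont
      (fun τ hτ => (hBd τ (by linarith [hτ.2])).hasDerivWithinAt)
      (fun τ hτ => by
        have hτ1 : 0 < 1 - τ := by linarith [hτ.2]
        rw [norm_mul, hun, mul_one]
        have h1 := hQ' (τ * u) (by rw [hnorm τ hτ.1]; linarith [hτ.2])
        rw [hnorm τ hτ.1] at h1
        refine h1.trans ?_
        have h2 := hK t (1 - τ) ht (by linarith [hτ.2]) (by linarith [hτ.1])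
        calc A * (φ (1 - τ) / (1 - τ) ^ 2)
            ≤ A * (K * φ t * ((1 - τ) / t) ^ β / (1 - τ) ^ 2) := by gcongr
          _ = D * (1 - τ) ^ (β - 2) := by
            rw [Real.div_rpow hτ1.le ht.le, hD, Real.rpow_neg ht.le, Real.rpow_sub hτ1,
              Real.rpow_two]
            ring)
      (right_mem_Icc.2 hr0.le)
    simp only [hzu] at key
    refine key.trans_eq ?_
    rw [← ht_def, hD, Real.rpow_sub ht, Real.rpow_neg ht.le, Real.rpow_one]
    field_simp
  have hφh := hφ_pos (1 / 2) (by norm_num)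
  have hb : 0 < 1 - β := by linarith
  refine ⟨2 * (A * K / (1 - β)) + 8 * μ.real univ / φ (1 / 2), by positivity, fun z hz => ?_⟩
  have ht : 0 < 1 - ‖z‖ := by linarith
  have ht1 : 1 - ‖z‖ ≤ 1 := by linarith [norm_nonneg z]
  have hφt := hφ_pos _ ⟨ht, ht1⟩
  have hμ0 : 0 ≤ μ.real univ := measureReal_nonneg
  rw [add_mul]
  -- The bound for `Q = z H'` can be divided by `z` only away from the origin; near it the trivial
  -- bound for `H'` suffices.
  rcases le_total (1 / 2) ‖z‖ with h | h
  · have h1 := hQb z hz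
    simp only [hQ, norm_mul] at h1
    have h2 : ‖deriv (herglotzIntegral μ) z‖ ≤ 2 * (‖z‖ * ‖deriv (herglotzIntegral μ) z‖) := by
      nlinarith [norm_nonneg (deriv (herglotzIntegral μ) z)]
    have h3 : 0 ≤ 8 * μ.real univ / φ (1 / 2) * (φ (1 - ‖z‖) / (1 - ‖z‖)) := by positivity
    linarith
  · have h1 := norm_deriv_herglotzIntegral_le μ hz
    have h2 : φ (1 / 2) ≤ φ (1 - ‖z‖) / (1 - ‖z‖) := by
      rw [le_div_iff₀ ht]
      have := hφ_mono ⟨by norm_num, by norm_num⟩ ⟨ht, ht1⟩ (by linarith : 1 / 2 ≤ 1 - ‖z‖)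
      nlinarith
    have h3 : 0 ≤ 2 * (A * K / (1 - β)) * (φ (1 - ‖z‖) / (1 - ‖z‖)) := by positivity
    have h4 : 2 / (1 - ‖z‖) ^ 2 ≤ 8 := by
      rw [div_le_iff₀ (by positivity)]
      nlinarith
    calc _ ≤ 8 * μ.real univ := h1.trans (by gcongr)
      _ = 8 * μ.real univ / φ (1 / 2) * φ (1 / 2) := by field_simp
      _ ≤ 8 * μ.real univ / φ (1 / 2) * (φ (1 - ‖z‖) / (1 - ‖z‖)) := by gcongr
      _ ≤ _ := by linarith

/-! ### Parseval, Littlewood-Paley and Grönwall. -/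

theorem integral_exp_int_mul_I (m : ℤ) :
    ∫ θ in (-Real.pi)..Real.pi, Complex.exp (m * Complex.I * θ) =
      if m = 0 then (2 * Real.pi : ℂ) else 0 := by
  split_ifs with h
  · simp [h, two_mul]
  · rw [integral_exp_mul_complex (mul_ne_zero (by exact_mod_cast h) Complex.I_ne_zero)]
    have : Complex.exp (m * Complex.I * (Real.pi : ℝ)) =
        Complex.exp (m * Complex.I * (-Real.pi : ℝ)) := by
      rw [Complex.exp_eq_exp_iff_exists_int]
      exact ⟨m, by push_cast; ring⟩
    rw [this, sub_self, zero_div]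

/-- Parseval's identity for an absolutely convergent one-sided trigonometric series. -/
theorem hasSum_sq_norm_of_hasSum_exp {c : ℕ → ℂ} {f : ℝ → ℂ} (hc : Summable fun n => ‖c n‖)
    (hf : ∀ θ : ℝ, HasSum (fun n : ℕ => c n * Complex.exp (n * Complex.I * θ)) (f θ)) :
    HasSum (fun n => ‖c n‖ ^ 2)
      ((2 * Real.pi)⁻¹ * ∫ θ in (-Real.pi)..Real.pi, ‖f θ‖ ^ 2) := by
  have hnorm : ∀ (m : ℤ) (θ : ℝ), ‖Complex.exp (m * Complex.I * θ)‖ = 1 := fun m θ => by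
    rw [show (m * Complex.I * θ : ℂ) = ((m * θ : ℝ) : ℂ) * Complex.I by push_cast; ring]
    exact Complex.norm_exp_ofReal_mul_I _
  have hnorm' : ∀ (n : ℕ) (θ : ℝ), ‖c n * Complex.exp (n * Complex.I * θ)‖ = ‖c n‖ := fun n θ => by
    rw [norm_mul, ← Int.cast_natCast, hnorm, mul_one]
  have hft : f = fun θ : ℝ => ∑' n, c n * Complex.exp (n * Complex.I * θ) :=
    funext fun θ => (hf θ).tsum_eq.symm
  have hfc : Continuous f := by
    rw [hft]
    exact continuous_tsum (fun n => by fun_prop) hc fun n θ => (hnorm' n θ).le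
  have hpi := Real.pi_pos
  have hab : -Real.pi < Real.pi := by linarith
  have hL2 : MemLp f 2 (volume.restrict (Ioc (-Real.pi) Real.pi)) := by
    refine MemLp.of_bound hfc.aestronglyMeasurable (∑' n, ‖c n‖) (ae_of_all _ fun θ => ?_)
    rw [hft]
    refine (norm_tsum_le_tsum_norm (by simpa only [hnorm'] using hc)).trans_eq ?_
    simp only [hnorm']
  have hcoef : ∀ m : ℤ, fourierCoeffOn hab f m = if 0 ≤ m then c m.toNat else 0 := by
    intro m
    rw [fourierCoeffOn_eq_integral]
    have e1 : ∀ θ : ℝ, fourier (-m) (θ : AddCircle (Real.pi - -Real.pi)) • f θ =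
        ∑' n : ℕ, c n * Complex.exp ((n - m : ℤ) * Complex.I * θ) := fun θ => by
      rw [fourier_coe_apply, smul_eq_mul, hft, ← tsum_mul_left]
      refine tsum_congr fun n => ?_
      rw [mul_left_comm, ← Complex.exp_add]
      congr 2
      have : (Real.pi : ℂ) ≠ 0 := by exact_mod_cast hpi.ne'
      push_cast
      field_simp
      ring
    simp_rw [e1]
    have hs := hasSum_integral_of_summable_integral_norm
      (μ := volume.restrict (Ioc (-Real.pi) Real.pi))
      (F := fun (n : ℕ) (θ : ℝ) => c n * Complex.exp ((n - m : ℤ) * Complex.I * θ))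
      (fun n => (Continuous.integrableOn_Ioc (by fun_prop))) (by
        simp only [norm_mul, hnorm, mul_one, integral_const, smul_eq_mul]
        exact hc.mul_left _)
    have e2 : ∀ n : ℕ, ∫ θ in Ioc (-Real.pi) Real.pi,
        c n * Complex.exp ((n - m : ℤ) * Complex.I * θ) =
        if (n : ℤ) = m then 2 * Real.pi * c n else 0 := fun n => by
      rw [← intervalIntegral.integral_of_le hab.le, intervalIntegral.integral_const_mul,
        integral_exp_int_mul_I]
      by_cases h : (n : ℤ) = m
      · simp [h, mul_comm]
      · simp [h, sub_ne_zero.2 h]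
    simp_rw [e2] at hs
    rw [intervalIntegral.integral_of_le hab.le, ← hs.tsum_eq]
    have hpi' : (Real.pi : ℂ) ≠ 0 := by exact_mod_cast hpi.ne'
    split_ifs with h
    · obtain ⟨k, rfl⟩ := Int.eq_ofNat_of_zero_le h
      rw [tsum_eq_single k (fun n hn => if_neg (by exact_mod_cast hn)), if_pos rfl]
      simp only [Int.toNat_natCast, Complex.real_smul]
      push_cast
      field_simp
      ring
    · have : ∀ n : ℕ, (n : ℤ) ≠ m := fun n hn => h (hn ▸ Int.natCast_nonneg n)
      simp [this]
  have hP := hasSum_sq_fourierCoeffOn hab hL2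
  rw [sub_neg_eq_add, ← two_mul, smul_eq_mul] at hP
  rw [← Function.Injective.hasSum_iff (g := ((↑) : ℕ → ℤ)) Nat.cast_injective] at hP
  · convert hP using 2 with n
    simp [hcoef]
  · intro m hm
    rw [hcoef, if_neg, norm_zero, zero_pow two_ne_zero]
    intro h
    exact hm ⟨m.toNat, Int.toNat_of_nonneg h⟩

/-- The integral of `‖F‖ ^ 2` over the circle of radius `r`. -/
noncomputable def circleEnergy (F : ℂ → ℂ) (r : ℝ) : ℝ :=
  ∫ θ in (-Real.pi)..Real.pi, ‖F (r * Complex.exp (θ * Complex.I))‖ ^ 2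

theorem norm_ofReal_mul_exp {r : ℝ} (hr : 0 ≤ r) (θ : ℝ) :
    ‖(r : ℂ) * Complex.exp (θ * Complex.I)‖ = r := by
  rw [norm_mul, Complex.norm_exp_ofReal_mul_I, mul_one, Complex.norm_real, Real.norm_of_nonneg hr]

theorem hasSum_circleEnergy {F : ℂ → ℂ} {a : ℕ → ℂ}
    (hF : ∀ z : ℂ, ‖z‖ < 1 → HasSum (fun n => a n * z ^ n) (F z)) {r : ℝ} (h0 : 0 ≤ r)
    (h1 : r < 1) :
    HasSum (fun n => ‖a n‖ ^ 2 * r ^ (2 * n)) ((2 * Real.pi)⁻¹ * circleEnergy F r) := by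
  have h := hasSum_sq_norm_of_hasSum_exp (c := fun n => a n * r ^ n)
    (f := fun θ => F (r * Complex.exp (θ * Complex.I))) ?_ fun θ => ?_
  · unfold circleEnergy
    convert h using 2 with n
    rw [norm_mul, mul_pow, norm_pow, Complex.norm_real, Real.norm_of_nonneg h0, ← pow_mul,
      mul_comm 2]
  · exact (hF r (by rwa [Complex.norm_real, Real.norm_of_nonneg h0])).summable.norm
  · convert hF _ ((norm_ofReal_mul_exp h0 θ).trans_lt h1) using 2 with n
    rw [mul_pow, ← Complex.exp_nat_mul]
    ring_nf

theorem integral_sub_mul_pow (r : ℝ) (n : ℕ) :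
    ∫ ρ in (0 : ℝ)..r, (r - ρ) * ρ ^ (2 * n) =
      r ^ (2 * n + 2) / ((2 * n + 1) * (2 * n + 2)) := by
  have : ∀ ρ : ℝ, (r - ρ) * ρ ^ (2 * n) = r * ρ ^ (2 * n) - ρ ^ (2 * n + 1) := fun ρ => by ring
  simp_rw [this]
  rw [intervalIntegral.integral_sub, intervalIntegral.integral_const_mul, integral_pow,
    integral_pow]
  · push_cast
    field_simp
    ring
  · exact Continuous.intervalIntegrable (by fun_prop) _ _
  · exact Continuous.intervalIntegrable (by fun_prop) _ _

theorem exists_hasSum_taylor {F : ℂ → ℂ} (hF : DifferentiableOn ℂ F (Metric.ball 0 1)) :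
    ∃ a : ℕ → ℂ, (∀ z : ℂ, ‖z‖ < 1 → HasSum (fun n => a n * z ^ n) (F z)) ∧
      (∀ z : ℂ, ‖z‖ < 1 → HasSum (fun n : ℕ => ((n + 1 : ℕ) * a (n + 1)) * z ^ n) (deriv F z)) ∧
      a 0 = F 0 := by
  refine ⟨fun n => (n.factorial : ℂ)⁻¹ * iteratedDeriv n F 0, fun z hz => ?_, fun z hz => ?_, ?_⟩
  · refine (Complex.hasSum_taylorSeries_on_ball hF (by simpa using hz)).congr_fun fun n => ?_
    rw [sub_zero, smul_eq_mul, smul_eq_mul]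
    ring
  · refine (Complex.hasSum_taylorSeries_on_ball (hF.deriv Metric.isOpen_ball)
      (by simpa using hz)).congr_fun fun n => ?_
    simp only [sub_zero, smul_eq_mul, iteratedDeriv_succ', Nat.factorial_succ]
    have : (n.factorial : ℂ) ≠ 0 := by exact_mod_cast n.factorial_ne_zero
    have : (n + 1 : ℂ) ≠ 0 := by exact_mod_cast n.succ_ne_zero
    push_cast
    field_simp
  · simp

/-- An integral form of the Littlewood-Paley identity. -/
theorem circleEnergy_le {F : ℂ → ℂ} (hF : DifferentiableOn ℂ F (Metric.ball 0 1)) {r : ℝ}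
    (h0 : 0 ≤ r) (h1 : r < 1) {G : ℝ → ℝ} (hG : Continuous G)
    (hFG : ∀ ρ ∈ Icc 0 r, 4 * (1 - ρ) * circleEnergy (deriv F) ρ ≤ G ρ) :
    circleEnergy F r ≤ 2 * Real.pi * ‖F 0‖ ^ 2 + ∫ ρ in (0 : ℝ)..r, G ρ := by
  have hpi := Real.pi_pos
  obtain ⟨a, hFa, hFa', ha0⟩ := exists_hasSum_taylor hF
  have hsum := hasSum_circleEnergy hFa h0 h1
  have hsum' : ∀ ρ ∈ Icc 0 r, HasSum (fun n : ℕ => ((n + 1) ^ 2 * ‖a (n + 1)‖ ^ 2) * ρ ^ (2 * n))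
      ((2 * Real.pi)⁻¹ * circleEnergy (deriv F) ρ) := by
    intro ρ hρ
    refine (hasSum_circleEnergy hFa' hρ.1 (hρ.2.trans_lt h1)).congr_fun fun n => ?_
    rw [norm_mul, mul_pow, Complex.norm_natCast]
    push_cast
    ring
  have hshift := (hasSum_nat_add_iff' 1).2 hsum
  simp only [Finset.range_one, Finset.sum_singleton, mul_zero, pow_zero, mul_one, ha0] at hshift
  -- Only finite partial sums are compared, so no infinite sum is interchanged with the radial
  -- integral.
  have key := hasSum_le_of_sum_le hshift
    (c := (2 * Real.pi)⁻¹ * ∫ ρ in (0 : ℝ)..r, G ρ) fun s => ?_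
  · have := mul_le_mul_of_nonneg_left key (by positivity : 0 ≤ 2 * Real.pi)
    rw [mul_sub, ← mul_assoc, ← mul_assoc, mul_inv_cancel₀ (by positivity), one_mul, one_mul] at this
    linarith
  · have hterm : ∀ n : ℕ, ‖a (n + 1)‖ ^ 2 * r ^ (2 * (n + 1)) ≤
        ∫ ρ in (0 : ℝ)..r, 4 * (r - ρ) * (((n + 1) ^ 2 * ‖a (n + 1)‖ ^ 2) * ρ ^ (2 * n)) := by
      intro n
      have : ∀ ρ : ℝ, 4 * (r - ρ) * (((n + 1) ^ 2 * ‖a (n + 1)‖ ^ 2) * ρ ^ (2 * n)) =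
          (4 * (n + 1) ^ 2 * ‖a (n + 1)‖ ^ 2) * ((r - ρ) * ρ ^ (2 * n)) := fun ρ => by ring
      simp_rw [this]
      rw [intervalIntegral.integral_const_mul, integral_sub_mul_pow]
      -- This is where the factor `4` in the weight is used: `4 (n + 1)² = (2 n + 2)²`.
      have hfac : (1 : ℝ) ≤ 4 * (n + 1) ^ 2 / ((2 * n + 1) * (2 * n + 2)) := by
        rw [one_le_div (by positivity)]
        nlinarith
      calc _ ≤ (‖a (n + 1)‖ ^ 2 * r ^ (2 * (n + 1))) *
            (4 * (n + 1) ^ 2 / ((2 * n + 1) * (2 * n + 2))) :=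
            le_mul_of_one_le_right (by positivity) hfac
        _ = _ := by rw [show 2 * (n + 1) = 2 * n + 2 by ring]; ring
    refine (Finset.sum_le_sum fun n _ => hterm n).trans ?_
    rw [← intervalIntegral.integral_finsetSum fun n _ =>
      Continuous.intervalIntegrable (by fun_prop) _ _, ← intervalIntegral.integral_const_mul]
    refine intervalIntegral.integral_mono_on h0 (Continuous.intervalIntegrable (by fun_prop) _ _)
      (Continuous.intervalIntegrable (by fun_prop) _ _) fun ρ hρ => ?_
    rw [← Finset.mul_sum]
    have hle := sum_le_hasSum s (fun n _ => by have := hρ.1; positivity) (hsum' ρ hρ)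
    have hnn : 0 ≤ (2 * Real.pi)⁻¹ * circleEnergy (deriv F) ρ :=
      (Finset.sum_nonneg fun n _ => by have := hρ.1; positivity).trans hle
    calc _ ≤ 4 * (r - ρ) * ((2 * Real.pi)⁻¹ * circleEnergy (deriv F) ρ) := by
          have : 0 ≤ r - ρ := sub_nonneg.2 hρ.2
          gcongr
      _ ≤ 4 * (1 - ρ) * ((2 * Real.pi)⁻¹ * circleEnergy (deriv F) ρ) := by gcongr
      _ = (2 * Real.pi)⁻¹ * (4 * (1 - ρ) * circleEnergy (deriv F) ρ) := by ring
      _ ≤ _ := by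
          gcongr
          exact hFG ρ hρ

/-- Grönwall's inequality in integral form with a variable coefficient. -/
theorem le_mul_exp_integral_of_le_add_integral {M k : ℝ → ℝ} {A R : ℝ} (hM : Continuous M)
    (hk : Continuous k) (hR : 0 ≤ R) (hk0 : ∀ r ∈ Icc 0 R, 0 ≤ k r)
    (h : ∀ r ∈ Icc 0 R, M r ≤ A + ∫ ρ in (0 : ℝ)..r, k ρ * M ρ) :
    M R ≤ A * Real.exp (∫ ρ in (0 : ℝ)..R, k ρ) := by
  set I : ℝ → ℝ := fun r => A + ∫ ρ in (0 : ℝ)..r, k ρ * M ρ with hI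
  set K : ℝ → ℝ := fun r => ∫ ρ in (0 : ℝ)..r, k ρ with hK
  have hkM : Continuous fun ρ => k ρ * M ρ := hk.mul hM
  have hId : ∀ r, HasDerivAt I (k r * M r) r := fun r =>
    (intervalIntegral.integral_hasDerivAt_right (hkM.intervalIntegrable _ _)
      (hkM.stronglyMeasurableAtFilter _ _) hkM.continuousAt).const_add A
  have hKd : ∀ r, HasDerivAt K (k r) r := fun r =>
    intervalIntegral.integral_hasDerivAt_right (hk.intervalIntegrable _ _)
      (hk.stronglyMeasurableAtFilter _ _) hk.continuousAt
  have hJd : ∀ r, HasDerivAt (fun r => I r * Real.exp (-K r))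
      ((k r * M r) * Real.exp (-K r) + I r * (Real.exp (-K r) * -k r)) r := fun r =>
    (hId r).mul (hKd r).neg.exp
  have hanti : AntitoneOn (fun r => I r * Real.exp (-K r)) (Icc 0 R) := by
    refine antitoneOn_of_deriv_nonpos (convex_Icc 0 R)
      (fun r _ => (hJd r).continuousAt.continuousWithinAt)
      (fun r _ => (hJd r).differentiableAt.differentiableWithinAt) fun r hr => ?_
    have hr' := interior_subset hr
    rw [(hJd r).deriv]
    have h1 := mul_le_mul_of_nonneg_left (h r hr') (hk0 r hr')
    nlinarith [Real.exp_pos (-K r)]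
  have h2 := hanti (left_mem_Icc.2 hR) (right_mem_Icc.2 hR) hR
  simp only [hI, hK, intervalIntegral.integral_same, add_zero, neg_zero, Real.exp_zero,
    mul_one] at h2
  refine (h R (right_mem_Icc.2 hR)).trans ?_
  rw [Real.exp_neg] at h2
  rwa [← div_eq_mul_inv, div_le_iff₀ (Real.exp_pos _)] at h2

theorem continuous_circleEnergy_comp {F : ℂ → ℂ} (hF : ContinuousOn F (Metric.ball 0 1))
    {c : ℝ → ℝ} (hc : Continuous c) (hc0 : ∀ ρ, 0 ≤ c ρ) (hc1 : ∀ ρ, c ρ < 1) :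
    Continuous fun ρ => circleEnergy F (c ρ) := by
  unfold circleEnergy
  refine intervalIntegral.continuous_parametric_intervalIntegral_of_continuous' ?_ _ _
  refine (Continuous.norm ?_).pow 2
  refine hF.comp_continuous (by fun_prop) fun p => ?_
  rw [mem_ball_zero_iff, norm_ofReal_mul_exp (hc0 _)]
  exact hc1 _

/-- Integrated over circles, the pointwise bound on `F'` closes the Littlewood-Paley inequality into
one for the energy of `F` alone, to which Grönwall applies. -/
theorem circleEnergy_le_mul_exp {F : ℂ → ℂ} (hF : DifferentiableOn ℂ F (Metric.ball 0 1))
    {k : ℝ → ℝ} (hk : ContinuousOn k (Ico 0 1)) (hk0 : ∀ ρ ∈ Ico (0 : ℝ) 1, 0 ≤ k ρ)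
    (hFk : ∀ z : ℂ, ‖z‖ < 1 → 4 * (1 - ‖z‖) * ‖deriv F z‖ ^ 2 ≤ k ‖z‖ * ‖F z‖ ^ 2)
    {r : ℝ} (h0 : 0 ≤ r) (h1 : r < 1) :
    circleEnergy F r ≤ 2 * Real.pi * ‖F 0‖ ^ 2 * Real.exp (∫ ρ in (0 : ℝ)..r, k ρ) := by
  -- Clamping to `[0, r]` makes the energy and `k` continuous on all of `ℝ` without changing them on
  -- `[0, r]`.
  set c : ℝ → ℝ := fun ρ => max 0 (min ρ r) with hc
  have hcc : Continuous c := by fun_prop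
  have hc0 : ∀ ρ, 0 ≤ c ρ := fun ρ => le_max_left _ _
  have hc1 : ∀ ρ, c ρ < 1 := fun ρ => max_lt one_pos ((min_le_right _ _).trans_lt h1)
  have hcid : ∀ ρ ∈ Icc 0 r, c ρ = ρ := fun ρ hρ => by
    simp [hc, min_eq_left hρ.2, max_eq_right hρ.1]
  have hMc : Continuous fun ρ => circleEnergy F (c ρ) :=
    continuous_circleEnergy_comp hF.continuousOn hcc hc0 hc1
  have hkc : Continuous fun ρ => k (c ρ) := hk.comp_continuous hcc fun ρ => ⟨hc0 ρ, hc1 ρ⟩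
  have hint : ∀ ρ ∈ Icc 0 r, ∀ G : ℂ → ℂ, ContinuousOn G (Metric.ball 0 1) →
      IntervalIntegrable (fun θ : ℝ => ‖G (ρ * Complex.exp (θ * Complex.I))‖ ^ 2) volume
        (-Real.pi) Real.pi := fun ρ hρ G hG => by
    refine Continuous.intervalIntegrable ((Continuous.norm ?_).pow 2) _ _
    refine hG.comp_continuous (by fun_prop) fun θ => ?_
    rw [mem_ball_zero_iff, norm_ofReal_mul_exp hρ.1]
    exact hρ.2.trans_lt h1
  have hkM : ∀ ρ ∈ Icc 0 r, 4 * (1 - ρ) * circleEnergy (deriv F) ρ ≤ k ρ * circleEnergy F ρ := by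
    intro ρ hρ
    unfold circleEnergy
    rw [← intervalIntegral.integral_const_mul, ← intervalIntegral.integral_const_mul]
    refine intervalIntegral.integral_mono_on (by linarith [Real.pi_pos])
      ((hint ρ hρ _ (hF.deriv Metric.isOpen_ball).continuousOn).const_mul _)
      ((hint ρ hρ _ hF.continuousOn).const_mul _) fun θ _ => ?_
    have := hFk (ρ * Complex.exp (θ * Complex.I))
      (by rw [norm_ofReal_mul_exp hρ.1]; exact hρ.2.trans_lt h1)
    rwa [norm_ofReal_mul_exp hρ.1] at this
  have key := le_mul_exp_integral_of_le_add_integral (A := 2 * Real.pi * ‖F 0‖ ^ 2) hMc hkc h0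
    (fun ρ _ => hk0 _ ⟨hc0 ρ, hc1 ρ⟩) fun s hs => ?_
  · rw [hcid r (right_mem_Icc.2 h0)] at key
    refine key.trans_eq ?_
    congr 2
    refine intervalIntegral.integral_congr fun ρ hρ => ?_
    rw [uIcc_of_le h0] at hρ
    simp only [hcid ρ hρ]
  · rw [hcid s hs]
    refine circleEnergy_le hF hs.1 (hs.2.trans_lt h1) (hkc.mul hMc) fun ρ hρ => ?_
    have hρ' : ρ ∈ Icc 0 r := ⟨hρ.1, hρ.2.trans hs.2⟩
    simp only [hcid ρ hρ']
    exact hkM ρ hρ'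

/-! ### The function `⟨φ⟩` and exponential integrability. -/

section Bracket

variable {φ : ℝ → ℝ}

theorem continuousOn_sq_div (hφ_cont : ContinuousOn φ (Ioc (0 : ℝ) 1)) :
    ContinuousOn (fun t => φ t ^ 2 / t) (Ioc (0 : ℝ) 1) :=
  (hφ_cont.pow 2).div continuousOn_id fun _ ht => ht.1.ne'

theorem intervalIntegrable_sq_div (hφ_cont : ContinuousOn φ (Ioc (0 : ℝ) 1)) {s u : ℝ}
    (hs : s ∈ Ioc (0 : ℝ) 1) (hu : u ∈ Ioc (0 : ℝ) 1) :
    IntervalIntegrable (fun t => φ t ^ 2 / t) volume s u :=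
  ((continuousOn_sq_div hφ_cont).mono (ordConnected_Ioc.uIcc_subset hs hu)).intervalIntegrable

theorem sq_bracket {s : ℝ} (hs : s ∈ Ioc (0 : ℝ) 1) :
    bracket φ s ^ 2 = ∫ t in s..1, φ t ^ 2 / t := by
  refine Real.sq_sqrt (intervalIntegral.integral_nonneg hs.2 fun t ht => ?_)
  have : 0 < t := hs.1.trans_le ht.1
  positivity

theorem bracket_nonneg (s : ℝ) : 0 ≤ bracket φ s := Real.sqrt_nonneg _

theorem bracket_antitoneOn (hφ_cont : ContinuousOn φ (Ioc (0 : ℝ) 1)) :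
    AntitoneOn (bracket φ) (Ioc (0 : ℝ) 1) := by
  intro s hs u hu hsu
  refine Real.sqrt_le_sqrt ?_
  rw [← intervalIntegral.integral_add_adjacent_intervals (intervalIntegrable_sq_div hφ_cont hs hu)
    (intervalIntegrable_sq_div hφ_cont hu (by simp))]
  refine le_add_of_nonneg_left (intervalIntegral.integral_nonneg hsu fun t ht => ?_)
  have : 0 < t := hs.1.trans_le ht.1
  positivity

theorem bracket_half_pos (hφ_pos : ∀ t ∈ Ioc (0 : ℝ) 1, 0 < φ t)
    (hφ_cont : ContinuousOn φ (Ioc (0 : ℝ) 1)) : 0 < bracket φ (1 / 2) := by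
  have h1 : (1 / 2 : ℝ) ∈ Ioc (0 : ℝ) 1 := by norm_num
  refine Real.sqrt_pos.2 (intervalIntegral.intervalIntegral_pos_of_pos_on
    (intervalIntegrable_sq_div hφ_cont h1 (by simp)) (fun t ht => ?_) (by norm_num))
  have ht0 : 0 < t := by linarith [ht.1]
  have := hφ_pos t ⟨ht0, ht.2.le⟩
  positivity

/-- The factor `⟨φ⟩` can be dropped: on `(0, 1/2]` it is at least `⟨φ⟩(1/2) > 0`. It vanishes at
`1`, so `(1/2, 1]` is treated separately, by boundedness of the integrand. -/
theorem lintegral_rpow_div_mul_exp_bracket_lt_top {p ε : ℝ} (hp : 0 < p) (hε : 0 < ε)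
    (hφ_pos : ∀ t ∈ Ioc (0 : ℝ) 1, 0 < φ t) (hφ_cont : ContinuousOn φ (Ioc (0 : ℝ) 1))
    (hφ_mono : MonotoneOn φ (Ioc (0 : ℝ) 1))
    (hint : IntegrableOn
      (fun t : ℝ => φ t ^ p / t * bracket φ t * Real.exp (ε * bracket φ t ^ 2))
      (Ioc (0 : ℝ) 1)) :
    ∫⁻ t in Ioc (0 : ℝ) 1, ENNReal.ofReal (φ t ^ p / t * Real.exp (ε * bracket φ t ^ 2)) < ∞ := by
  have hb := bracket_half_pos hφ_pos hφ_cont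
  set b := bracket φ (1 / 2) with hbdef
  have hh : (1 / 2 : ℝ) ∈ Ioc (0 : ℝ) 1 := by norm_num
  rw [← Ioc_union_Ioc_eq_Ioc (by norm_num : (0 : ℝ) ≤ 1 / 2) (by norm_num : (1 / 2 : ℝ) ≤ 1)]
  refine (lintegral_union_le _ _ _).trans_lt (ENNReal.add_lt_top.2 ⟨?_, ?_⟩)
  · have hfin := ((hint.mono_set (Ioc_subset_Ioc_right (by norm_num : (1 / 2 : ℝ) ≤ 1))).const_mul
      b⁻¹).lintegral_lt_top
    refine (setLIntegral_mono' measurableSet_Ioc fun t ht => ?_).trans_lt hfin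
    refine ENNReal.ofReal_le_ofReal ?_
    have ht' : t ∈ Ioc (0 : ℝ) 1 := ⟨ht.1, by linarith [ht.2]⟩
    have h1 : b ≤ bracket φ t := bracket_antitoneOn hφ_cont ht' hh ht.2
    have h2 : 1 ≤ b⁻¹ * bracket φ t := by
      rw [inv_mul_eq_div, one_le_div hb]
      exact h1
    have h3 : 0 ≤ φ t ^ p / t := div_nonneg (Real.rpow_nonneg (hφ_pos t ht').le p) ht.1.le
    calc φ t ^ p / t * Real.exp (ε * bracket φ t ^ 2)
        ≤ (φ t ^ p / t * Real.exp (ε * bracket φ t ^ 2)) * (b⁻¹ * bracket φ t) :=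
          le_mul_of_one_le_right (by positivity) h2
      _ = _ := by ring
  · refine (setLIntegral_mono' (g := fun _ => ENNReal.ofReal (φ 1 ^ p / (1 / 2) *
      Real.exp (ε * b ^ 2))) measurableSet_Ioc fun t ht => ?_).trans_lt ?_
    · refine ENNReal.ofReal_le_ofReal ?_
      have ht' : t ∈ Ioc (0 : ℝ) 1 := ⟨by linarith [ht.1], ht.2⟩
      have h1 : bracket φ t ≤ b := bracket_antitoneOn hφ_cont hh ht' ht.1.le
      have h2 : φ t ≤ φ 1 := hφ_mono ht' (by simp) ht.2
      have h3 := hφ_pos t ht'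
      have h4 := hφ_pos 1 (by simp)
      have h5 := ht.1.le
      have h6 := bracket_nonneg (φ := φ) t
      gcongr
    · rw [setLIntegral_const]
      exact ENNReal.mul_lt_top ENNReal.ofReal_lt_top (by simp)

/-- Exponential integrability of the Poisson integral of a smooth measure on circles. -/
theorem lintegral_exp_re_herglotzIntegral_le (hφ_cont : ContinuousOn φ (Ioc (0 : ℝ) 1))
    (μ : Measure UnitAddCircle) [IsFiniteMeasure μ] {C : ℝ}
    (hC : ∀ z : ℂ, ‖z‖ < 1 →
      ‖deriv (herglotzIntegral μ) z‖ ≤ C * (φ (1 - ‖z‖) / (1 - ‖z‖)))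
    {l : ℝ} (hl : 0 ≤ l) {r : ℝ} (h0 : 0 ≤ r) (h1 : r < 1) :
    ∫⁻ θ in Ioo (-Real.pi) Real.pi, ENNReal.ofReal
      (Real.exp (l * (herglotzIntegral μ (r * Complex.exp (θ * Complex.I))).re)) ≤
    ENNReal.ofReal (2 * Real.pi * Real.exp (l * μ.real univ) *
      Real.exp ((l * C) ^ 2 * bracket φ (1 - r) ^ 2)) := by
  -- With the exponent halved, `|F|² = exp (l Re H)`, and the `4` of Littlewood-Paley cancels `(1 /
  -- 2)²`. The Grönwall coefficient is then `(l C)² φ(t)² / t`, whose integral is `(l C)² ⟨φ⟩²`.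
  set F : ℂ → ℂ := fun z => Complex.exp ((l / 2 : ℝ) * herglotzIntegral μ z) with hF
  have hFn : ∀ z, ‖F z‖ ^ 2 = Real.exp (l * (herglotzIntegral μ z).re) := fun z => by
    rw [hF, Complex.norm_exp, Complex.re_ofReal_mul, ← Real.exp_nat_mul]
    push_cast
    ring_nf
  have hFd : ∀ z : ℂ, ‖z‖ < 1 →
      HasDerivAt F (F z * ((l / 2 : ℝ) * deriv (herglotzIntegral μ) z)) z := fun z hz =>
    ((hasDerivAt_herglotzIntegral μ hz).differentiableAt.hasDerivAt.const_mul _).cexp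
  have hFdiff : DifferentiableOn ℂ F (Metric.ball 0 1) := fun z hz =>
    (hFd z (by simpa using hz)).differentiableAt.differentiableWithinAt
  have hmaps : MapsTo (fun ρ : ℝ => 1 - ρ) (Ico 0 1) (Ioc 0 1) := fun ρ hρ =>
    ⟨by linarith [hρ.2], by linarith [hρ.1]⟩
  have key := circleEnergy_le_mul_exp hFdiff
    (k := fun ρ => (l * C) ^ 2 * (φ (1 - ρ) ^ 2 / (1 - ρ)))
    (continuousOn_const.mul ((continuousOn_sq_div hφ_cont).comp (by fun_prop) hmaps))
    (fun ρ hρ => by have := sub_pos.2 hρ.2; positivity) (fun z hz => ?_) h0 h1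
  · have hF0 : ‖F 0‖ ^ 2 = Real.exp (l * μ.real univ) := by
      rw [hFn, herglotzIntegral_zero, Complex.ofReal_re]
    have hint : ∫ ρ in (0 : ℝ)..r, (l * C) ^ 2 * (φ (1 - ρ) ^ 2 / (1 - ρ)) =
        (l * C) ^ 2 * bracket φ (1 - r) ^ 2 := by
      rw [intervalIntegral.integral_const_mul,
        intervalIntegral.integral_comp_sub_left (fun t => φ t ^ 2 / t), sub_zero,
        sq_bracket ⟨by linarith, by linarith⟩]
    rw [hF0, hint] at key
    have hcont : Continuous fun θ : ℝ =>
        Real.exp (l * (herglotzIntegral μ (r * Complex.exp (θ * Complex.I))).re) := by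
      refine Real.continuous_exp.comp (continuous_const.mul (Complex.continuous_re.comp ?_))
      refine (differentiableOn_herglotzIntegral μ).continuousOn.comp_continuous (by fun_prop)
        fun θ => ?_
      rwa [mem_ball_zero_iff, norm_ofReal_mul_exp h0]
    rw [← ofReal_integral_eq_lintegral_ofReal
        (hcont.integrableOn_Ioc.mono_set Ioo_subset_Ioc_self)
        (ae_of_all _ fun θ => (Real.exp_pos _).le)]
    refine ENNReal.ofReal_le_ofReal (le_trans (le_of_eq ?_) key)
    rw [circleEnergy, intervalIntegral.integral_of_le (by linarith [Real.pi_pos]),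
      integral_Ioc_eq_integral_Ioo]
    simp only [hFn]
  · rw [(hFd z hz).deriv, norm_mul, norm_mul, Complex.norm_real, Real.norm_of_nonneg (by positivity)]
    have ht : 0 < 1 - ‖z‖ := by linarith
    have h2 : ‖deriv (herglotzIntegral μ) z‖ ^ 2 ≤ (C * (φ (1 - ‖z‖) / (1 - ‖z‖))) ^ 2 :=
      pow_le_pow_left₀ (norm_nonneg _) (hC z hz) 2
    calc 4 * (1 - ‖z‖) * (‖F z‖ * (l / 2 * ‖deriv (herglotzIntegral μ) z‖)) ^ 2
        = (1 - ‖z‖) * l ^ 2 * ‖F z‖ ^ 2 * ‖deriv (herglotzIntegral μ) z‖ ^ 2 := by ring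
      _ ≤ (1 - ‖z‖) * l ^ 2 * ‖F z‖ ^ 2 * (C * (φ (1 - ‖z‖) / (1 - ‖z‖))) ^ 2 := by gcongr
      _ = _ := by field_simp

end Bracket

/-! ### Integration over the disc in polar coordinates. -/

section Polar

theorem lintegral_unitDisc_eq_polar {h : ℂ → ℝ≥0∞} (hh : Measurable h) :
    ∫⁻ z in Metric.ball (0 : ℂ) 1, h z =
      ∫⁻ ρ in Ioo (0 : ℝ) 1, ∫⁻ θ in Ioo (-Real.pi) Real.pi,
        ENNReal.ofReal ρ * h (ρ * Complex.exp (θ * Complex.I)) := by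
  have hm : MeasurableSet (Metric.ball (0 : ℂ) 1) := Metric.isOpen_ball.measurableSet
  have hsymm : ∀ q : ℝ × ℝ,
      Complex.polarCoord.symm q = q.1 * Complex.exp (q.2 * Complex.I) := fun q => by
    rw [Complex.polarCoord_symm_apply, Complex.exp_mul_I]
    push_cast
    ring
  rw [← lintegral_indicator hm, ← Complex.lintegral_comp_polarCoord_symm, polarCoord_target]
  simp_rw [hsymm, smul_eq_mul]
  have hmeas : Measurable fun q : ℝ × ℝ => ENNReal.ofReal q.1 *
      (Metric.ball (0 : ℂ) 1).indicator h (q.1 * Complex.exp (q.2 * Complex.I)) :=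
    (ENNReal.measurable_ofReal.comp measurable_fst).mul
      ((hh.indicator hm).comp (by fun_prop))
  rw [Measure.volume_eq_prod, ← Measure.prod_restrict, lintegral_prod _ hmeas.aemeasurable]
  have hIoo : Ioo (0 : ℝ) 1 = Iio 1 ∩ Ioi 0 := by rw [inter_comm, Ioi_inter_Iio]
  rw [hIoo, ← Measure.restrict_restrict measurableSet_Iio,
    ← lintegral_indicator measurableSet_Iio]
  refine setLIntegral_congr_fun measurableSet_Ioi fun ρ hρ => ?_
  have hn := norm_ofReal_mul_exp (le_of_lt (show (0 : ℝ) < ρ from hρ))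
  by_cases h1 : ρ < 1
  · rw [indicator_of_mem (show ρ ∈ Iio 1 from h1)]
    refine lintegral_congr fun θ => ?_
    rw [indicator_of_mem]
    rwa [mem_ball_zero_iff, hn]
  · rw [indicator_of_notMem (show ρ ∉ Iio 1 from h1)]
    refine (lintegral_congr fun θ => ?_).trans lintegral_zero
    rw [indicator_of_notMem, mul_zero]
    rwa [mem_ball_zero_iff, hn]

theorem lintegral_unitDisc_le {h : ℂ → ℝ≥0∞} (hh : Measurable h) {V : ℝ → ℝ≥0∞}
    (hV : ∀ ρ ∈ Ioo (0 : ℝ) 1,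
      ∫⁻ θ in Ioo (-Real.pi) Real.pi, h (ρ * Complex.exp (θ * Complex.I)) ≤ V ρ) :
    ∫⁻ z in Metric.ball (0 : ℂ) 1, h z ≤ ∫⁻ ρ in Ioo (0 : ℝ) 1, V ρ := by
  rw [lintegral_unitDisc_eq_polar hh]
  refine setLIntegral_mono' measurableSet_Ioo fun ρ hρ => ?_
  have hcomp : Measurable fun θ : ℝ => h (ρ * Complex.exp (θ * Complex.I)) :=
    hh.comp (by fun_prop)
  rw [lintegral_const_mul _ hcomp]
  calc _ ≤ 1 * V ρ := by
        gcongr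
        · exact ENNReal.ofReal_le_one.2 hρ.2.le
        · exact hV ρ hρ
    _ = V ρ := one_mul _

/-- Dominated convergence in polar coordinates: first on each circle, then in the radius. -/
theorem tendsto_lintegral_unitDisc_zero {h : ℕ → ℂ → ℝ≥0∞} (hh : ∀ n, Measurable (h n))
    (hlim : ∀ z : ℂ, ‖z‖ < 1 → Tendsto (fun n => h n z) atTop (𝓝 0))
    (hbdd : ∀ ρ ∈ Ioo (0 : ℝ) 1, ∃ c : ℝ≥0∞, c ≠ ∞ ∧
      ∀ n (θ : ℝ), h n (ρ * Complex.exp (θ * Complex.I)) ≤ c)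
    {V : ℝ → ℝ≥0∞} (hVfin : ∫⁻ ρ in Ioo (0 : ℝ) 1, V ρ ≠ ∞)
    (hV : ∀ n, ∀ ρ ∈ Ioo (0 : ℝ) 1,
      ∫⁻ θ in Ioo (-Real.pi) Real.pi, h n (ρ * Complex.exp (θ * Complex.I)) ≤ V ρ) :
    Tendsto (fun n => ∫⁻ z in Metric.ball (0 : ℂ) 1, h n z) atTop (𝓝 0) := by
  simp_rw [fun n => lintegral_unitDisc_eq_polar (hh n)]
  have hcomp : ∀ n (ρ : ℝ), Measurable fun θ : ℝ => h n (ρ * Complex.exp (θ * Complex.I)) :=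
    fun n ρ => (hh n).comp (by fun_prop)
  have h0 : (0 : ℝ≥0∞) = ∫⁻ _ in Ioo (0 : ℝ) 1, 0 := by simp
  rw [h0]
  -- `V` dominates only the circle integrals. A pointwise bound uniform in `n` is needed on each
  -- fixed circle alone, where it may depend on the radius.
  refine tendsto_lintegral_of_dominated_convergence V (fun n => ?_) (fun n => ?_) hVfin ?_
  · refine Measurable.lintegral_prod_right' (f := fun q : ℝ × ℝ =>
      ENNReal.ofReal q.1 * h n (q.1 * Complex.exp (q.2 * Complex.I))) ?_
    exact (ENNReal.measurable_ofReal.comp measurable_fst).mul ((hh n).comp (by fun_prop))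
  · filter_upwards [ae_restrict_mem measurableSet_Ioo] with ρ hρ
    rw [lintegral_const_mul _ (hcomp n ρ)]
    calc _ ≤ 1 * V ρ := by
          gcongr
          · exact ENNReal.ofReal_le_one.2 hρ.2.le
          · exact hV n ρ hρ
      _ = V ρ := one_mul _
  · filter_upwards [ae_restrict_mem measurableSet_Ioo] with ρ hρ
    obtain ⟨c, hc, hle⟩ := hbdd ρ hρ
    have hinner : Tendsto (fun n => ∫⁻ θ in Ioo (-Real.pi) Real.pi,
        h n (ρ * Complex.exp (θ * Complex.I))) atTop (𝓝 0) := by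
      have h0 : (0 : ℝ≥0∞) = ∫⁻ _ in Ioo (-Real.pi) Real.pi, 0 := by simp
      rw [h0]
      refine tendsto_lintegral_of_dominated_convergence (fun _ => c) (fun n => hcomp n ρ)
        (fun n => ae_of_all _ fun θ => hle n θ) ?_ (ae_of_all _ fun θ => hlim _ ?_)
      · rw [setLIntegral_const]
        exact ENNReal.mul_ne_top hc (by simp)
      · rw [norm_ofReal_mul_exp hρ.1.le]
        exact hρ.2
    have hmul := ENNReal.Tendsto.const_mul hinner
      (Or.inr (ENNReal.ofReal_ne_top : ENNReal.ofReal ρ ≠ ∞))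
    rw [mul_zero] at hmul
    exact hmul.congr fun n => (lintegral_const_mul _ (hcomp n ρ)).symm

theorem setLIntegral_Ioo_one_sub (f : ℝ → ℝ≥0∞) :
    ∫⁻ ρ in Ioo (0 : ℝ) 1, f (1 - ρ) = ∫⁻ t in Ioo (0 : ℝ) 1, f t := by
  have hpre : (fun ρ : ℝ => 1 - ρ) ⁻¹' Ioo 0 1 = Ioo 0 1 := by simp
  have := (Measure.measurePreserving_sub_left volume (1 : ℝ)).setLIntegral_comp_preimage_emb
    (MeasurableEquiv.subLeft (1 : ℝ)).measurableEmbedding f (Ioo 0 1)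
  rwa [hpre] at this

end Polar

/-! ### Polynomial approximation of the inverse of `S_μ ^ α`. -/

/-- Dilations of a holomorphic function on the disc are approximated by polynomials together with
their derivatives, uniformly on the closed disc. -/
theorem exists_polynomial_near_dilation {F : ℂ → ℂ}
    (hF : DifferentiableOn ℂ F (Metric.ball 0 1)) {r : ℝ} (h0 : 0 ≤ r) (h1 : r < 1) {δ : ℝ}
    (hδ : 0 < δ) :
    ∃ q : Polynomial ℂ, ∀ z : ℂ, ‖z‖ < 1 → ‖q.eval z - F (r * z)‖ ≤ δ ∧
      ‖q.derivative.eval z - r * deriv F (r * z)‖ ≤ δ := by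
  obtain ⟨a, hFa, hFa', -⟩ := exists_hasSum_taylor hF
  have hrn : ‖(r : ℂ)‖ = r := by rw [Complex.norm_real, Real.norm_of_nonneg h0]
  have hrz : ∀ z ∈ Metric.ball (0 : ℂ) 1, ‖(r : ℂ) * z‖ ≤ r := fun z hz => by
    rw [norm_mul, hrn]
    exact mul_le_of_le_one_right h0 (by simpa using (mem_ball_zero_iff.1 hz).le)
  have unif : ∀ (b : ℕ → ℂ) (G : ℂ → ℂ),
      (∀ z : ℂ, ‖z‖ < 1 → HasSum (fun n => b n * z ^ n) (G z)) →
      ∀ᶠ N in atTop, ∀ z ∈ Metric.ball (0 : ℂ) 1,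
        ‖∑ n ∈ Finset.range N, b n * (r * z) ^ n - G (r * z)‖ ≤ δ := by
    intro b G hG
    have hsum := (hG r (by rwa [hrn])).summable.norm
    have hu := tendstoUniformlyOn_tsum_nat (f := fun n z => b n * (r * z) ^ n)
      (s := Metric.ball (0 : ℂ) 1) hsum fun n z hz => by
        rw [norm_mul, norm_mul, norm_pow, norm_pow, hrn]
        have := hrz z hz
        gcongr
    filter_upwards [Metric.tendstoUniformlyOn_iff.1 hu δ hδ] with N hN z hz
    have h := hN z hz
    rw [(hG (r * z) ((hrz z hz).trans_lt h1)).tsum_eq, dist_comm, dist_eq_norm] at h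
    exact h.le
  -- A Taylor sum with `N + 1` terms has a derivative with `N` terms, hence the shift in the first
  -- condition.
  obtain ⟨N, hN, hN'⟩ := ((tendsto_add_atTop_nat 1).eventually (unif a F hFa)).and
    (unif _ _ hFa') |>.exists
  refine ⟨∑ n ∈ Finset.range (N + 1), Polynomial.C (a n * r ^ n) * Polynomial.X ^ n,
    fun z hz => ⟨?_, ?_⟩⟩
  · convert hN z (by simpa using hz) using 2
    rw [Polynomial.eval_finsetSum]
    congr 1
    refine Finset.sum_congr rfl fun n _ => ?_
    simp only [Polynomial.eval_mul, Polynomial.eval_C, Polynomial.eval_pow, Polynomial.eval_X]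
    ring
  · have heq : (∑ n ∈ Finset.range (N + 1),
        Polynomial.C (a n * r ^ n) * Polynomial.X ^ n : Polynomial ℂ).derivative.eval z =
        r * ∑ n ∈ Finset.range N, ((n + 1 : ℕ) * a (n + 1)) * (r * z) ^ n := by
      rw [Polynomial.derivative_sum, Polynomial.eval_finsetSum, Finset.sum_range_succ',
        Finset.mul_sum]
      simp only [Polynomial.derivative_C_mul, Polynomial.derivative_X_pow, Polynomial.eval_mul,
        Polynomial.eval_C, Polynomial.eval_pow, Polynomial.eval_X, Polynomial.eval_natCast,
        Nat.cast_zero, zero_mul, mul_zero, add_zero, Nat.add_sub_cancel, map_natCast]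
      refine Finset.sum_congr rfl fun n _ => ?_
      ring
    rw [heq, ← mul_sub, norm_mul, hrn]
    exact (mul_le_of_le_one_left (norm_nonneg _) h1.le).trans (hN' z (by simpa using hz))

section SingularInner

variable (μ : Measure UnitAddCircle) [IsFiniteMeasure μ]

theorem hasDerivAt_singularInnerPow (α : ℝ) {z : ℂ} (hz : ‖z‖ < 1) :
    HasDerivAt (singularInnerPow μ α)
      (singularInnerPow μ α z * (α * -deriv (herglotzIntegral μ) z)) z :=
  ((hasDerivAt_herglotzIntegral μ hz).differentiableAt.hasDerivAt.neg.const_mul _).cexp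

theorem norm_singularInnerPow_le_one {α : ℝ} (hα : 0 ≤ α) {z : ℂ} (hz : ‖z‖ < 1) :
    ‖singularInnerPow μ α z‖ ≤ 1 := by
  rw [singularInnerPow, Complex.norm_exp, Complex.re_ofReal_mul, Complex.neg_re]
  refine Real.exp_le_one_iff.2 ?_
  nlinarith [re_herglotzIntegral_nonneg μ hz]

end SingularInner

theorem measurable_besov_integrand (p : ℝ) (f : ℂ → ℂ) :
    Measurable fun z : ℂ => ENNReal.ofReal ((1 - ‖z‖) ^ (p - 1) * ‖deriv f z‖ ^ p) := by
  have h := measurable_deriv f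
  exact (((measurable_const.sub measurable_norm).pow_const _).mul
    (h.norm.pow_const _)).ennreal_ofReal

/-- The product rule estimate for a perturbation `q` of `G`, with primes for derivatives. -/
theorem norm_deriv_polynomial_mul_le {S G q q' G' S' : ℂ} {δ : ℝ} (hδ : 0 ≤ δ) (hS : ‖S‖ ≤ 1)
    (hq : ‖q - G‖ ≤ δ) (hq' : ‖q' - G'‖ ≤ δ) :
    ‖q' * S + q * S'‖ ≤ δ + δ * ‖S'‖ + ‖G' * S + G * S'‖ := by
  have : q' * S + q * S' = (q' - G') * S + (q - G) * S' + (G' * S + G * S') := by ring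
  rw [this]
  refine (norm_add₃_le).trans ?_
  rw [norm_mul, norm_mul]
  have := norm_nonneg S
  gcongr
  calc _ ≤ δ * 1 := by gcongr
    _ = δ := mul_one δ

/-- Polynomials `q` for which `q * S_μ ^ α` is close to `1`. -/
theorem exists_polynomial_mul_singularInnerPow (μ : Measure UnitAddCircle) [IsFiniteMeasure μ]
    {α : ℝ} (hα : 0 ≤ α) {r : ℝ} (h0 : 0 ≤ r) (h1 : r < 1) {δ : ℝ} (hδ : 0 < δ) :
    ∃ q : Polynomial ℂ, ‖q.eval 0 * singularInnerPow μ α 0 - 1‖ ≤ δ ∧ ∀ z : ℂ, ‖z‖ < 1 →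
      ‖deriv (fun z => q.eval z * singularInnerPow μ α z - 1) z‖ ≤
        δ + δ * (α * ‖deriv (herglotzIntegral μ) z‖) +
          α * ‖r * deriv (herglotzIntegral μ) (r * z) - deriv (herglotzIntegral μ) z‖ *
            Real.exp (α * (herglotzIntegral μ (r * z)).re) := by
  set H := herglotzIntegral μ with hH
  set S := singularInnerPow μ α with hS
  set G : ℂ → ℂ := fun z => Complex.exp (α * H z) with hG
  have hHd : ∀ z : ℂ, ‖z‖ < 1 → HasDerivAt H (deriv H z) z := fun z hz =>
    (hasDerivAt_herglotzIntegral μ hz).differentiableAt.hasDerivAt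
  have hGd : ∀ z : ℂ, ‖z‖ < 1 → HasDerivAt G (G z * (α * deriv H z)) z := fun z hz =>
    ((hHd z hz).const_mul _).cexp
  have hGdiff : DifferentiableOn ℂ G (Metric.ball 0 1) := fun z hz =>
    (hGd z (by simpa using hz)).differentiableAt.differentiableWithinAt
  obtain ⟨q, hq⟩ := exists_polynomial_near_dilation hGdiff h0 h1 hδ
  have hrz : ∀ z : ℂ, ‖z‖ < 1 → ‖(r : ℂ) * z‖ < 1 := fun z hz => by
    rw [norm_mul, Complex.norm_real, Real.norm_of_nonneg h0]
    exact (mul_le_of_le_one_right h0 hz.le).trans_lt h1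
  refine ⟨q, ?_, fun z hz => ?_⟩
  · have h := (hq 0 (by simp)).1
    rw [mul_zero] at h
    have hGS : G 0 * S 0 = 1 := by
      simp only [hG, hS, singularInnerPow]
      rw [← Complex.exp_add, mul_neg, add_neg_cancel, Complex.exp_zero]
    rw [← hGS, ← sub_mul, norm_mul]
    exact (mul_le_of_le_one_right (norm_nonneg _)
      (norm_singularInnerPow_le_one μ hα (by simp))).trans h
  · have hSd := hasDerivAt_singularInnerPow μ α hz
    have hS1 := norm_singularInnerPow_le_one μ hα hz
    rw [← hH, ← hS] at hSd
    rw [← hS] at hS1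
    have hd := ((q.hasDerivAt z).mul hSd).sub_const 1
    rw [show deriv (fun z => q.eval z * S z - 1) z = _ from hd.deriv]
    obtain ⟨hq0, hq1⟩ := hq z hz
    refine (norm_deriv_polynomial_mul_le hδ.le hS1 hq0 hq1).trans ?_
    have e1 : ‖S z * (α * -deriv H z)‖ ≤ α * ‖deriv H z‖ := by
      rw [norm_mul, norm_mul, norm_neg, Complex.norm_real, Real.norm_of_nonneg hα]
      exact mul_le_of_le_one_left (by positivity) hS1
    -- The logarithmic derivatives of `G(r z)` and `S` nearly cancel: the difference `r H'(r z) -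
    -- H'(z)` tends to zero as `r → 1`.
    have e2 : r * deriv G (r * z) * S z + G (r * z) * (S z * (α * -deriv H z)) =
        S z * (α * (r * deriv H (r * z) - deriv H z) * G (r * z)) := by
      rw [(hGd _ (hrz z hz)).deriv]
      ring
    have e3 : ‖S z * (α * (r * deriv H (r * z) - deriv H z) * G (r * z))‖ ≤
        α * ‖r * deriv H (r * z) - deriv H z‖ * Real.exp (α * (H (r * z)).re) := by
      have hGn : ‖G (r * z)‖ = Real.exp (α * (H (r * z)).re) := by
        simp only [hG, Complex.norm_exp, Complex.re_ofReal_mul]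
      rw [norm_mul, norm_mul, norm_mul, hGn, Complex.norm_real, Real.norm_of_nonneg hα]
      exact mul_le_of_le_one_left (by positivity) hS1
    rw [e2]
    gcongr

/-! ### Circle integrals of the norm, and the conclusion. -/

theorem rpow_sub_one_mul_rpow {p t B w x : ℝ} (ht : 0 < t) (hB : 0 ≤ B) (hw : 0 ≤ w) :
    t ^ (p - 1) * (B * (w / t) * Real.exp x) ^ p = B ^ p * (w ^ p / t) * Real.exp (p * x) := by
  rw [Real.mul_rpow (by positivity) (Real.exp_pos x).le, Real.mul_rpow hB (by positivity),
    Real.div_rpow hw ht.le, ← Real.exp_mul, Real.rpow_sub_one ht.ne', mul_comm x p]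
  have := (Real.rpow_pos_of_pos ht p).ne'
  field_simp

theorem rpow_sub_one_mul_rpow_le {p t B w x d : ℝ} (hp : 0 ≤ p) (ht : 0 < t) (hB : 0 ≤ B)
    (hw : 0 ≤ w) (hd0 : 0 ≤ d) (hd : d ≤ B * (w / t) * Real.exp x) :
    t ^ (p - 1) * d ^ p ≤ B ^ p * (w ^ p / t) * Real.exp (p * x) := by
  rw [← rpow_sub_one_mul_rpow ht hB hw]
  gcongr

/-- The weight reduces `(φ / t) ^ p` to `φ ^ p / t`, and exponential integrability with `l = p α` on
the circle of radius `r ρ` treats the rest. Since `⟨φ⟩` is antitone, `⟨φ⟩(1 - r ρ) ≤ ⟨φ⟩(1 - ρ)`, so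
the bound does not depend on `r`. -/
theorem lintegral_circle_besov_le {φ : ℝ → ℝ} (hφ_pos : ∀ t ∈ Ioc (0 : ℝ) 1, 0 < φ t)
    (hφ_cont : ContinuousOn φ (Ioc (0 : ℝ) 1))
    (μ : Measure UnitAddCircle) [IsFiniteMeasure μ] {C : ℝ}
    (hC : ∀ z : ℂ, ‖z‖ < 1 →
      ‖deriv (herglotzIntegral μ) z‖ ≤ C * (φ (1 - ‖z‖) / (1 - ‖z‖)))
    {p α ε B r ρ : ℝ} (hp : 0 ≤ p) (hα : 0 ≤ α) (hε : (p * α * C) ^ 2 = ε) (hB : 0 ≤ B)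
    (hr0 : 0 ≤ r) (hr1 : r < 1) (hρ : ρ ∈ Ioo (0 : ℝ) 1) {f : ℂ → ℂ}
    (hf : ∀ z : ℂ, ‖z‖ < 1 → ‖deriv f z‖ ≤ B * (φ (1 - ‖z‖) / (1 - ‖z‖)) *
      Real.exp (α * (herglotzIntegral μ (r * z)).re)) :
    ∫⁻ θ in Ioo (-Real.pi) Real.pi, ENNReal.ofReal
      ((1 - ‖(ρ : ℂ) * Complex.exp (θ * Complex.I)‖) ^ (p - 1) *
        ‖deriv f (ρ * Complex.exp (θ * Complex.I))‖ ^ p) ≤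
    ENNReal.ofReal (B ^ p * (2 * Real.pi * Real.exp (p * α * μ.real univ))) *
      ENNReal.ofReal (φ (1 - ρ) ^ p / (1 - ρ) * Real.exp (ε * bracket φ (1 - ρ) ^ 2)) := by
  have ht : 0 < 1 - ρ := by linarith [hρ.2]
  have htm : 1 - ρ ∈ Ioc (0 : ℝ) 1 := ⟨ht, by linarith [hρ.1]⟩
  have hφt := hφ_pos _ htm
  have hrρ0 : 0 ≤ r * ρ := mul_nonneg hr0 hρ.1.le
  have hrρ : r * ρ ≤ ρ := mul_le_of_le_one_left hρ.1.le hr1.le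
  calc _ ≤ ∫⁻ θ in Ioo (-Real.pi) Real.pi,
        ENNReal.ofReal (B ^ p * (φ (1 - ρ) ^ p / (1 - ρ))) * ENNReal.ofReal (Real.exp
          (p * α * (herglotzIntegral μ ((r * ρ : ℝ) * Complex.exp (θ * Complex.I))).re)) := by
        refine lintegral_mono fun θ => ?_
        rw [← ENNReal.ofReal_mul (by positivity)]
        refine ENNReal.ofReal_le_ofReal ?_
        have hn := norm_ofReal_mul_exp hρ.1.le θ
        have h := hf (ρ * Complex.exp (θ * Complex.I)) (by rw [hn]; exact hρ.2)
        rw [hn] at h ⊢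
        refine (rpow_sub_one_mul_rpow_le hp ht hB hφt.le (norm_nonneg _) h).trans_eq ?_
        rw [mul_assoc p α, Complex.ofReal_mul, mul_assoc (r : ℂ)]
    _ = ENNReal.ofReal (B ^ p * (φ (1 - ρ) ^ p / (1 - ρ))) *
        ∫⁻ θ in Ioo (-Real.pi) Real.pi, ENNReal.ofReal (Real.exp
          (p * α * (herglotzIntegral μ ((r * ρ : ℝ) * Complex.exp (θ * Complex.I))).re)) :=
        lintegral_const_mul' _ _ ENNReal.ofReal_ne_top
    _ ≤ ENNReal.ofReal (B ^ p * (φ (1 - ρ) ^ p / (1 - ρ))) *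
        ENNReal.ofReal (2 * Real.pi * Real.exp (p * α * μ.real univ) *
          Real.exp (ε * bracket φ (1 - ρ) ^ 2)) := by
        gcongr
        refine (lintegral_exp_re_herglotzIntegral_le hφ_cont μ hC (mul_nonneg hp hα) hrρ0
          (by linarith [hρ.2])).trans (ENNReal.ofReal_le_ofReal ?_)
        rw [hε]
        have hmono : bracket φ (1 - r * ρ) ≤ bracket φ (1 - ρ) :=
          bracket_antitoneOn hφ_cont htm ⟨by linarith [hρ.2], by linarith⟩ (by linarith)
        have := bracket_nonneg (φ := φ) (1 - r * ρ)
        have : 0 ≤ ε := hε ▸ sq_nonneg _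
        gcongr
    _ = _ := by
        rw [← ENNReal.ofReal_mul (by positivity), ← ENNReal.ofReal_mul (by positivity)]
        congr 1
        ring

theorem theorem3 (p : ℝ) (hp : 0 < p)
    (φ : ℝ → ℝ) (hφ_pos : ∀ t ∈ Ioc (0 : ℝ) 1, 0 < φ t)
    (hφ_cont : ContinuousOn φ (Ioc (0 : ℝ) 1)) (hφ_mono : MonotoneOn φ (Ioc (0 : ℝ) 1))
    (β : ℝ) (hβ0 : 0 < β) (hβ1 : β < 1) (hφ_dec : AlmostDecreasing (fun t => φ t / t ^ β))
    (μ : Measure UnitAddCircle) [IsFiniteMeasure μ]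
    (hμ_sing : μ ⟂ₘ (volume : Measure UnitAddCircle)) (hμ_smooth : IsSmoothMeasure φ μ)
    (ε : ℝ) (hε : 0 < ε)
    (hint : IntegrableOn
      (fun t : ℝ => φ t ^ p / t * bracket φ t * Real.exp (ε * bracket φ t ^ 2))
      (Ioc (0 : ℝ) 1)) :
    ∃ α : ℝ, 0 < α ∧ IsCyclicBesov p (singularInnerPow μ α) := by
  obtain ⟨C, hC0, hC⟩ :=
    norm_deriv_herglotzIntegral_le_of_isSmoothMeasure hφ_pos hφ_mono hβ1 hφ_dec μ hμ_smooth
  obtain ⟨K, hK1, hK⟩ := le_mul_rpow_of_almostDecreasing hφ_pos hφ_dec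
  have hg : ∀ t s : ℝ, 0 < t → t ≤ s → s ≤ 1 → φ s / s ≤ K * (φ t / t) := by
    intro t s ht hts hs
    have hφt := hφ_pos t ⟨ht, hts.trans hs⟩
    have hs0 := ht.trans_le hts
    have h2 : (s / t) ^ β ≤ s / t := by
      conv_rhs => rw [← Real.rpow_one (s / t)]
      exact Real.rpow_le_rpow_of_exponent_le ((one_le_div ht).2 hts) hβ1.le
    calc φ s / s ≤ K * φ t * (s / t) / s := by
          gcongr
          refine (hK t s ht hts hs).trans ?_
          gcongr
      _ = _ := by field_simp
  set α := Real.sqrt ε / (p * C) with hα_def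
  have hα : 0 < α := div_pos (Real.sqrt_pos.2 hε) (by positivity)
  have hαε : (p * α * C) ^ 2 = ε := by
    rw [show p * α * C = Real.sqrt ε by rw [hα_def]; field_simp, Real.sq_sqrt hε.le]
  set H := herglotzIntegral μ with hH
  have hφ1 := hφ_pos 1 (by simp)
  -- One summand for each term of the derivative estimate for `q S_μ ^ α - 1`, with `δ ≤ 1`. The
  -- first uses that `φ(t) / t ≥ φ(1) / K`, so a constant is absorbed by `φ(t) / t`.
  set B := K / φ 1 + α * C + α * (C * K + C) with hB_def
  have hB : 0 ≤ B := by positivity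
  set V : ℝ → ℝ≥0∞ := fun ρ =>
    ENNReal.ofReal (B ^ p * (2 * Real.pi * Real.exp (p * α * μ.real univ))) *
      ENNReal.ofReal (φ (1 - ρ) ^ p / (1 - ρ) * Real.exp (ε * bracket φ (1 - ρ) ^ 2)) with hV
  have hVfin : ∫⁻ ρ in Ioo (0 : ℝ) 1, V ρ < ∞ := by
    rw [lintegral_const_mul' _ _ ENNReal.ofReal_ne_top, setLIntegral_Ioo_one_sub fun t =>
      ENNReal.ofReal (φ t ^ p / t * Real.exp (ε * bracket φ t ^ 2))]
    exact ENNReal.mul_lt_top ENNReal.ofReal_lt_top ((lintegral_mono_set Ioo_subset_Ioc_self).trans_lt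
      (lintegral_rpow_div_mul_exp_bracket_lt_top hp hε hφ_pos hφ_cont hφ_mono hint))
  have hrz : ∀ r : ℝ, 0 ≤ r → r < 1 → ∀ z : ℂ, ‖z‖ < 1 → ‖(r : ℂ) * z‖ ≤ ‖z‖ := by
    intro r h0 h1 z hz
    rw [norm_mul, Complex.norm_real, Real.norm_of_nonneg h0]
    exact mul_le_of_le_one_left (norm_nonneg z) h1.le
  have hexp : ∀ z : ℂ, ‖z‖ < 1 → 1 ≤ Real.exp (α * (H z).re) := fun z hz =>
    Real.one_le_exp (mul_nonneg hα.le (re_herglotzIntegral_nonneg μ hz))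
  have hgpos : ∀ z : ℂ, ‖z‖ < 1 → 0 < φ (1 - ‖z‖) / (1 - ‖z‖) := fun z hz =>
    div_pos (hφ_pos _ ⟨by linarith, by linarith [norm_nonneg z]⟩) (by linarith)
  have hmem : MemBesov p (singularInnerPow μ α) := by
    refine ⟨fun z hz => (hasDerivAt_singularInnerPow μ α
      (by simpa using hz)).differentiableAt.differentiableWithinAt, ?_⟩
    refine ENNReal.add_lt_top.2 ⟨enorm_lt_top, ENNReal.rpow_lt_top_of_nonneg (by positivity) ?_⟩
    -- Membership is the case `r = 0` of the circle estimate, where the exponential factor is a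
    -- constant at least `1`.
    refine ((lintegral_unitDisc_le (measurable_besov_integrand p _) fun ρ hρ =>
      lintegral_circle_besov_le hφ_pos hφ_cont μ hC hp.le hα.le hαε hB le_rfl one_pos hρ
        fun z hz => ?_).trans_lt hVfin).ne
    rw [(hasDerivAt_singularInnerPow μ α hz).deriv, norm_mul, norm_mul, norm_neg,
      Complex.norm_real, Real.norm_of_nonneg hα.le]
    have hgz := hgpos z hz
    have e0 : ‖((0 : ℝ) : ℂ) * z‖ < 1 := by simp
    calc _ ≤ 1 * (α * (C * (φ (1 - ‖z‖) / (1 - ‖z‖)))) := by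
          gcongr
          · exact norm_singularInnerPow_le_one μ hα.le hz
          · exact hC z hz
      _ = α * C * (φ (1 - ‖z‖) / (1 - ‖z‖)) := by ring
      _ ≤ B * (φ (1 - ‖z‖) / (1 - ‖z‖)) := by
          gcongr
          have : 0 ≤ K / φ 1 + α * (C * K + C) := by positivity
          linarith
      _ ≤ _ := le_mul_of_one_le_right (by positivity) (hexp _ e0)
  refine ⟨α, hα, hmem, ?_⟩
  set r : ℕ → ℝ := fun n => 1 - 1 / ((n : ℝ) + 1) with hr
  have hδ0 : ∀ n : ℕ, 0 < 1 / ((n : ℝ) + 1) := fun n => by positivity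
  have hδ1 : ∀ n : ℕ, 1 / ((n : ℝ) + 1) ≤ 1 := fun n => by
    rw [div_le_one (by positivity)]
    linarith [(Nat.cast_nonneg n : (0 : ℝ) ≤ n)]
  have hr0 : ∀ n, 0 ≤ r n := fun n => sub_nonneg.2 (hδ1 n)
  have hr1 : ∀ n, r n < 1 := fun n => sub_lt_self _ (hδ0 n)
  have hδlim : Tendsto (fun n : ℕ => 1 / ((n : ℝ) + 1)) atTop (𝓝 0) :=
    tendsto_one_div_add_atTop_nhds_zero_nat
  have hrlim : Tendsto r atTop (𝓝 1) := by simpa [hr] using hδlim.const_sub 1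
  choose q hq0 hq using fun n =>
    exists_polynomial_mul_singularInnerPow μ hα.le (hr0 n) (hr1 n) (hδ0 n)
  rw [← hH] at hq
  refine ⟨q, ?_⟩
  have hbound : ∀ n, ∀ z : ℂ, ‖z‖ < 1 →
      ‖deriv (fun z => (q n).eval z * singularInnerPow μ α z - 1) z‖ ≤
        B * (φ (1 - ‖z‖) / (1 - ‖z‖)) * Real.exp (α * (H (r n * z)).re) := by
    intro n z hz
    have hw := hrz (r n) (hr0 n) (hr1 n) z hz
    have hw1 := hw.trans_lt hz
    have hgz := hgpos z hz
    have hE := hexp _ hw1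
    have ht : 0 < 1 - ‖z‖ := by linarith
    set g := φ (1 - ‖z‖) / (1 - ‖z‖) with hg_def
    have hH1 := hC z hz
    have hH2 : ‖deriv H (r n * z)‖ ≤ C * (K * g) :=
      (hC _ hw1).trans (by
        gcongr
        exact hg _ _ ht (by linarith) (by linarith [norm_nonneg ((r n : ℂ) * z)]))
    have hone : 1 ≤ K / φ 1 * g := by
      have h := hg _ 1 ht (by linarith [norm_nonneg z]) le_rfl
      rw [div_one] at h
      rw [div_mul_eq_mul_div, one_le_div hφ1]
      exact h
    have hdiff : ‖r n * deriv H (r n * z) - deriv H z‖ ≤ C * (K * g) + C * g := by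
      refine (norm_sub_le _ _).trans (add_le_add ?_ hH1)
      rw [norm_mul, Complex.norm_real, Real.norm_of_nonneg (hr0 n)]
      exact (mul_le_of_le_one_left (norm_nonneg _) (hr1 n).le).trans hH2
    calc _ ≤ _ := hq n z hz
      _ ≤ 1 * (K / φ 1 * g) + 1 * (α * (C * g)) + α * (C * (K * g) + C * g) *
          Real.exp (α * (H (r n * z)).re) := by
          have h1 := hδ1 n
          have : 1 / ((n : ℝ) + 1) ≤ 1 * (K / φ 1 * g) := by linarith
          gcongr
      _ ≤ (1 * (K / φ 1 * g) + 1 * (α * (C * g))) * Real.exp (α * (H (r n * z)).re) +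
          α * (C * (K * g) + C * g) * Real.exp (α * (H (r n * z)).re) := by
          gcongr
          exact le_mul_of_one_le_right (by positivity) hE
      _ = _ := by rw [hB_def]; ring
  have hlim : ∀ z : ℂ, ‖z‖ < 1 → Tendsto (fun n =>
      ‖deriv (fun z => (q n).eval z * singularInnerPow μ α z - 1) z‖) atTop (𝓝 0) := by
    intro z hz
    have hrC : Tendsto (fun n => (r n : ℂ)) atTop (𝓝 1) := by
      exact_mod_cast (Complex.continuous_ofReal.tendsto 1).comp hrlim
    have hrzlim : Tendsto (fun n => (r n : ℂ) * z) atTop (𝓝 z) := by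
      simpa using hrC.mul_const z
    have h1 := (differentiableAt_deriv_herglotzIntegral μ hz).continuousAt.tendsto.comp hrzlim
    have h2 := (hasDerivAt_herglotzIntegral μ hz).continuousAt.tendsto.comp hrzlim
    have h3 : Tendsto (fun n => α * ‖r n * deriv H (r n * z) - deriv H z‖ *
        Real.exp (α * (H (r n * z)).re)) atTop
        (𝓝 (α * ‖1 * deriv H z - deriv H z‖ * Real.exp (α * (H z).re))) :=
      (((hrC.mul h1).sub_const _).norm.const_mul α).mul
        ((Real.continuous_exp.tendsto _).comp
          (((Complex.continuous_re.tendsto _).comp h2).const_mul α))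
    have h4 := (hδlim.add (hδlim.mul_const (α * ‖deriv H z‖))).add h3
    simp only [zero_mul, add_zero, one_mul, sub_self, norm_zero, mul_zero] at h4
    exact squeeze_zero (fun _ => norm_nonneg _) (fun n => hq n z hz) h4
  have hint0 : Tendsto (fun n => ∫⁻ z in Metric.ball (0 : ℂ) 1, ENNReal.ofReal
      ((1 - ‖z‖) ^ (p - 1) *
        ‖deriv (fun z => (q n).eval z * singularInnerPow μ α z - 1) z‖ ^ p)) atTop (𝓝 0) := by
    refine tendsto_lintegral_unitDisc_zero (fun n => measurable_besov_integrand p _)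
      (fun z hz => ?_) (fun ρ hρ => ?_) hVfin.ne fun n ρ hρ =>
        lintegral_circle_besov_le hφ_pos hφ_cont μ hC hp.le hα.le hαε hB (hr0 n) (hr1 n) hρ
          (hbound n)
    · have h1 := ((hlim z hz).rpow_const (p := p) (Or.inr hp.le)).const_mul ((1 - ‖z‖) ^ (p - 1))
      rw [Real.zero_rpow hp.ne', mul_zero] at h1
      simpa using ENNReal.tendsto_ofReal h1
    · have ht : 0 < 1 - ρ := by linarith [hρ.2]
      -- On a fixed circle the crude bound `|H| ≤ 2 μ(𝕋) / (1 - ρ)` holds at all dilated points `r n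
      -- * z`, uniformly in `n`.
      refine ⟨ENNReal.ofReal (B ^ p * (φ (1 - ρ) ^ p / (1 - ρ)) *
        Real.exp (p * (α * (2 / (1 - ρ) * μ.real univ)))), ENNReal.ofReal_ne_top, fun n θ => ?_⟩
      refine ENNReal.ofReal_le_ofReal ?_
      have hn := norm_ofReal_mul_exp hρ.1.le θ
      have hz : ‖(ρ : ℂ) * Complex.exp (θ * Complex.I)‖ < 1 := by rw [hn]; exact hρ.2
      have hb := hbound n _ hz
      have hw := hrz (r n) (hr0 n) (hr1 n) _ hz
      have hw1 := hw.trans_lt hz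
      rw [hn] at hb hw ⊢
      refine rpow_sub_one_mul_rpow_le hp.le ht hB
        (hφ_pos _ ⟨ht, by linarith [hρ.1]⟩).le (norm_nonneg _) (hb.trans ?_)
      have hgz := hgpos _ hz
      rw [hn] at hgz
      gcongr
      refine (Complex.re_le_norm _).trans ((norm_herglotzIntegral_le μ hw1).trans ?_)
      gcongr
  have hzero : Tendsto (fun n => ‖(q n).eval 0 * singularInnerPow μ α 0 - 1‖ₑ) atTop (𝓝 0) := by
    have h := squeeze_zero (fun n => norm_nonneg _) hq0 hδlim
    simpa using ENNReal.tendsto_ofReal h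
  have hroot := (ENNReal.continuous_rpow_const (y := 1 / p)).tendsto 0 |>.comp hint0
  rw [ENNReal.zero_rpow_of_pos (by positivity)] at hroot
  simpa [besovNorm] using hzero.add hroot
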